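/- **Setting.** Let $d,N\ge 0$ and $M\ge 1$ be integers, $\varepsilon\ge 0$, and let $\Lambda\in\mathbb R^{d\times d}$ be symmetric positive definite. A random task $\tau$ consists of independent Gaussian vectors $w\sim\mathcal N(0,I_d)$ and $x_1,\dots,x_N,\,x^{\mathrm{sfx}}_1,\dots,x^{\mathrm{sfx}}_M,\,x_q\sim\mathcal N(0,\Lambda)$ in $\mathbb R^d$. Let $X=(x_1\cdots x_N)$, $X^{\mathrm{sfx}}=(x^{\mathrm{sfx}}_1\cdots x^{\mathrm{sfx}}_M)$, $Y=w^\top X$, $Y^{\mathrm{sfx}}=w^\top X^{\mathrm{sfx}}$, $y_q=w^\top x_q$, and $$E=\begin{pmatrix}X&X^{\mathrm{sfx}}&x_q\\ Y&Y^{\mathrm{sfx}}&0\end{pmatrix}.$$ The parameter is $\theta=(W^V,W^{KQ})$ with $W^{\square}=\begin{pmatrix}W^\square_{11}&w^\square_{12}\\(w^\square_{21})^\top&w^\square_{22}\end{pmatrix}\in\mathbb R^{(d+1)\times(d+1)}$, where $W^\square_{11}\in\mathbb R^{d\times d}$, for $\square\in\{V,KQ\}$. Put $v_\theta=((w^V_{21})^\top\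 \ w^V_{22})$ and $U_\theta=\begin{pmatrix}W^{KQ}_{11}\\(w^{KQ}_{21})^\top\end{pmatrix}$. The surrogate adversarial training (AT) loss is $\tilde{\mathcal L}(\theta)=\ell_1+\ell_2+\ell_3+\ell_4$ with $$\ell_1=2\,\mathbb E_\tau\Big[\Big(v_\theta\tfrac{EE^\top}{N+M}U_\theta x_q-y_q\Big)^2\Big],\qquad \ell_2=\tfrac{2\varepsilon^4M^2}{(N+M)^2}\|w^V_{21}\|_2^2\,\mathbb E_\tau\big[\|W^{KQ}_{11}x_q\|_2^2\big],$$ $$\ell_3=\tfrac{2\varepsilon^2M}{(N+M)^2}\,\mathbb E_\tau\Big[\|W^{KQ}_{11}x_q\|_2^2\,\Big\|v_\theta\begin{pmatrix}X^{\mathrm{sfx}}\\Y^{\mathrm{sfx}}\end{pmatrix}\Big\|_2^2\Big],\qquad \ell_4=\tfrac{2\varepsilon^2M}{(N+M)^2}\|w^V_{21}\|_2^2\,\mathbb E_\tau\Big[\Big\|\begin{pmatrix}X^{\mathrm{sfx}}\\Y^{\mathrm{sfx}}\end{pmatrix}^{\top}U_\theta x_q\Big\|_2^2\Big].$$ Let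 $\Gamma=\frac{N+M+1}{N+M}\Lambda+\frac{\mathrm{Tr}(\Lambda)}{N+M}I_d$, $\psi=\frac{M^2\,\mathrm{Tr}(\Lambda)}{(N+M)^2}$ and $A=\Gamma\Lambda+\varepsilon^2\psi I_d$. **Theorem.** Let $\sigma>0$ and let $\Theta\in\mathbb R^{d\times d}$ satisfy $\|\Theta\Theta^\top\|_F=1$ and $\Theta\Lambda\ne0$. Suppose $$\sigma<\sqrt{\frac{2}{d\,\|A\Lambda^{-1}\|_2}},$$ where $\|\cdot\|_2$ is the operator norm. Consider the gradient flow $\dot\theta(t)=-\nabla\tilde{\mathcal L}(\theta(t))$, $t\ge0$, on the space of all pairs $(W^V,W^{KQ})$ with the Euclidean (Frobenius) inner product, started from $$W^V(0)=\begin{pmatrix}0&0\\0&\sigma\end{pmatrix},\qquad W^{KQ}(0)=\begin{pmatrix}\sigma\Theta\Theta^\top&0\\0&0\end{pmatrix}.$$ Then a solution exists on $[0,\infty)$, and every such solution satisfies the following. For all $t\ge0$, all parameters other than $w^V_{22}$ and $W^{KQ}_{11}$ vanish, that is, $W^V_{11}=0$, $w^V_{12}=w^V_{21}=w^{KQ}_{12}=w^{KQ}_{21}=0$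 and $w^{KQ}_{22}=0$. As $t\to\infty$, $\theta(t)$ converges to some $\theta_*=(W^V_*,W^{KQ}_*)$ with the same vanishing blocks, the matrix $A$ is invertible, and $$w^V_{*,22}\,W^{KQ}_{*,11}=\big(\Gamma\Lambda+\varepsilon^2\psi I_d\big)^{-1}\Lambda .$$ -/

import Mathlib

open Set Filter Topology MeasureTheory ProbabilityTheory Matrix

namespace ICLAT

noncomputable section

/-- The Frobenius norm of a real square matrix. -/
def frobNorm {d : ℕ} (A : Matrix (Fin d) (Fin d) ℝ) : ℝ :=
  Matrix.frobeniusNormedAddCommGroup.toNorm.norm A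

open scoped Matrix.Norms.L2Operator in
/-- The operator norm of a real square matrix with respect to the Euclidean norm. -/
def opNorm {d : ℕ} (A : Matrix (Fin d) (Fin d) ℝ) : ℝ := ‖A‖

/-- The squared Euclidean norm of a finite real vector. -/
def sqNorm {ι : Type*} [Fintype ι] (v : ι → ℝ) : ℝ := ∑ i, v i ^ 2

/-! ### Parameters of the linear self-attention model -/

/-- Row and column indices of a `(d+1) × (d+1)` matrix, split into `d` and `1`. -/
abbrev Idx (d : ℕ) : Type := Fin d ⊕ Unit

/-- The parameter space of pairs `θ = (W^V, W^KQ)` of `(d+1) × (d+1)` matrices, with the Euclidean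
(Frobenius) inner product on all entries: the left summand indexes the entries of `W^V`, the right
summand those of `W^KQ`. -/
abbrev Param (d : ℕ) : Type := EuclideanSpace ℝ ((Idx d × Idx d) ⊕ (Idx d × Idx d))

/-- The pair `(W^V, W^KQ)` as a point of the parameter space. -/
def mkParam {d : ℕ} (V KQ : Matrix (Idx d) (Idx d) ℝ) : Param d :=
  WithLp.toLp 2 (Sum.elim (fun p => V p.1 p.2) (fun p => KQ p.1 p.2))

/-- The value matrix `W^V`. -/
def WV {d : ℕ} (θ : Param d) : Matrix (Idx d) (Idx d) ℝ :=
  Matrix.of fun i j => θ (Sum.inl (i, j))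

/-- The merged key-query matrix `W^KQ`. -/
def WKQ {d : ℕ} (θ : Param d) : Matrix (Idx d) (Idx d) ℝ :=
  Matrix.of fun i j => θ (Sum.inr (i, j))

/-- The block `W₁₁`. -/
def blk11 {d : ℕ} (W : Matrix (Idx d) (Idx d) ℝ) : Matrix (Fin d) (Fin d) ℝ := W.toBlocks₁₁

/-- The block `w₁₂`, the upper part of the last column. -/
def blk12 {d : ℕ} (W : Matrix (Idx d) (Idx d) ℝ) : Fin d → ℝ := fun i => W (Sum.inl i) (Sum.inr ())

/-- The block `w₂₁` (as a vector), the left part of the last row. -/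
def blk21 {d : ℕ} (W : Matrix (Idx d) (Idx d) ℝ) : Fin d → ℝ := fun j => W (Sum.inr ()) (Sum.inl j)

/-- The bottom right entry `w₂₂`. -/
def blk22 {d : ℕ} (W : Matrix (Idx d) (Idx d) ℝ) : ℝ := W (Sum.inr ()) (Sum.inr ())

/-- The row vector `((w^V₂₁)ᵀ  w^V₂₂)`. -/
def valRow {d : ℕ} (θ : Param d) : Idx d → ℝ :=
  Sum.elim (blk21 (WV θ)) (fun _ => blk22 (WV θ))

/-- The `(d+1) × d` matrix with rows `W^KQ₁₁` and `(w^KQ₂₁)ᵀ`. -/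
def kqCols {d : ℕ} (θ : Param d) : Matrix (Idx d) (Fin d) ℝ :=
  Matrix.fromRows (blk11 (WKQ θ)) (Matrix.replicateRow Unit (blk21 (WKQ θ)))

/-! ### The random linear regression task -/

/-- The randomness `τ = (w, x₁..x_N, x^sfx₁..x^sfx_M, x_q)` of a task. -/
abbrev Task (d N M : ℕ) : Type :=
  EuclideanSpace ℝ (Fin d) × (Fin N → EuclideanSpace ℝ (Fin d)) ×
    (Fin M → EuclideanSpace ℝ (Fin d)) × EuclideanSpace ℝ (Fin d)

/-- The law of a task: all components are independent, `w ∼ 𝒩(0, I)`, and the in-context, suffix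
and query samples are `𝒩(0, Λ)`. -/
def taskLaw {d : ℕ} (Λ : Matrix (Fin d) (Fin d) ℝ) (N M : ℕ) : Measure (Task d N M) :=
  (multivariateGaussian 0 1).prod
    ((Measure.pi fun _ : Fin N => multivariateGaussian 0 Λ).prod
      ((Measure.pi fun _ : Fin M => multivariateGaussian 0 Λ).prod (multivariateGaussian 0 Λ)))

variable {d N M : ℕ}

/-- The task weight `w`. -/
def Task.w (τ : Task d N M) : Fin d → ℝ := fun i => τ.1 i

/-- The matrix `X` whose columns are the in-context samples. -/
def Task.X (τ : Task d N M) : Matrix (Fin d) (Fin N) ℝ := Matrix.of fun i n => τ.2.1 n i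

/-- The matrix `X^sfx` whose columns are the clean suffix samples. -/
def Task.Xsfx (τ : Task d N M) : Matrix (Fin d) (Fin M) ℝ := Matrix.of fun i m => τ.2.2.1 m i

/-- The query sample `x_q`. -/
def Task.xq (τ : Task d N M) : Fin d → ℝ := fun i => τ.2.2.2 i

/-- The query label `y_q = wᵀ x_q`. -/
def Task.yq (τ : Task d N M) : ℝ := Task.w τ ⬝ᵥ Task.xq τ

/-- Samples `X` stacked on top of their labels `Y = wᵀ X`. -/
def withLabels {n : ℕ} (w : Fin d → ℝ) (X : Matrix (Fin d) (Fin n) ℝ) : Matrix (Idx d) (Fin n) ℝ :=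
  Matrix.fromRows X (Matrix.replicateRow Unit (w ᵥ* X))

/-- The suffix block `(X^sfx ; Y^sfx)`. -/
def Task.sfx (τ : Task d N M) : Matrix (Idx d) (Fin M) ℝ := withLabels (Task.w τ) (Task.Xsfx τ)

/-- The clean input `E^clean = (X X^sfx x_q ; Y Y^sfx 0)`. -/
def Task.Eclean (τ : Task d N M) : Matrix (Idx d) ((Fin N ⊕ Fin M) ⊕ Unit) ℝ :=
  Matrix.fromCols
    (Matrix.fromCols (withLabels (Task.w τ) (Task.X τ)) (Task.sfx τ))
    (Matrix.fromRows (Matrix.replicateCol Unit (Task.xq τ)) 0)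

/-! ### The surrogate adversarial training loss -/

variable (Λ : Matrix (Fin d) (Fin d) ℝ) (N M : ℕ) (ε : ℝ)

def loss1 (θ : Param d) : ℝ :=
  2 * ∫ τ : Task d N M,
    (valRow θ ⬝ᵥ
        (((1 / ((N : ℝ) + M)) • (Task.Eclean τ * (Task.Eclean τ)ᵀ)) *ᵥ (kqCols θ *ᵥ Task.xq τ))
      - Task.yq τ) ^ 2 ∂(taskLaw Λ N M)

def loss2 (θ : Param d) : ℝ :=
  2 * ε ^ 4 * (M : ℝ) ^ 2 / ((N : ℝ) + M) ^ 2 * sqNorm (blk21 (WV θ)) *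
    ∫ τ : Task d N M, sqNorm (blk11 (WKQ θ) *ᵥ Task.xq τ) ∂(taskLaw Λ N M)

def loss3 (θ : Param d) : ℝ :=
  2 * ε ^ 2 * (M : ℝ) / ((N : ℝ) + M) ^ 2 *
    ∫ τ : Task d N M,
      sqNorm (blk11 (WKQ θ) *ᵥ Task.xq τ) * sqNorm (valRow θ ᵥ* Task.sfx τ) ∂(taskLaw Λ N M)

def loss4 (θ : Param d) : ℝ :=
  2 * ε ^ 2 * (M : ℝ) / ((N : ℝ) + M) ^ 2 * sqNorm (blk21 (WV θ)) *
    ∫ τ : Task d N M,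
      sqNorm ((Task.sfx τ)ᵀ *ᵥ (kqCols θ *ᵥ Task.xq τ)) ∂(taskLaw Λ N M)

/-- The surrogate adversarial training loss with prompt length `N`, suffix length `M` and
perturbation radius `ε`. -/
def surrogateLoss (θ : Param d) : ℝ :=
  loss1 Λ N M θ + loss2 Λ N M ε θ + loss3 Λ N M ε θ + loss4 Λ N M ε θ

/-- `Γ(M) = (N+M+1)/(N+M) Λ + Tr(Λ)/(N+M) I`. -/
def Gam : Matrix (Fin d) (Fin d) ℝ :=
  (((N : ℝ) + M + 1) / ((N : ℝ) + M)) • Λ + (Λ.trace / ((N : ℝ) + M)) • (1 : Matrix _ _ ℝ)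

/-- `ψ(M) = M² Tr(Λ)/(N+M)²`. -/
def psi : ℝ := (M : ℝ) ^ 2 * Λ.trace / ((N : ℝ) + M) ^ 2

/-- `Γ(M) Λ + ε² ψ(M) I`. -/
def regMat : Matrix (Fin d) (Fin d) ℝ :=
  Gam Λ N M * Λ + (ε ^ 2 * psi Λ N M) • (1 : Matrix _ _ ℝ)

end

noncomputable section

/-- The initialization `W^V = (0 0 ; 0 σ)`, `W^KQ = (σ Θ Θᵀ 0 ; 0 0)`. -/
def initParam {d : ℕ} (σ : ℝ) (Θ : Matrix (Fin d) (Fin d) ℝ) : Param d :=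
  mkParam (Matrix.fromBlocks 0 0 0 (Matrix.of fun _ _ => σ))
    (Matrix.fromBlocks (σ • (Θ * Θᵀ)) 0 0 0)

/-- `γ : [0,∞) → E` solves the gradient flow equation `γ' = -∇L(γ)`; the loss is required to be
differentiable along `γ`, and the derivative at time `0` is one-sided. -/
def IsGradientFlow {E : Type*} [NormedAddCommGroup E] [InnerProductSpace ℝ E] [CompleteSpace E]
    (L : E → ℝ) (γ : ℝ → E) : Prop :=
  ∀ t : ℝ, 0 ≤ t → ∃ g : E, HasGradientAt L g (γ t) ∧ HasDerivWithinAt γ (-g) (Ici 0) t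

/-- All parameters other than `w^V₂₂` and `W^KQ₁₁` vanish. -/
def OffBlockZero {d : ℕ} (θ : Param d) : Prop :=
  blk11 (WV θ) = 0 ∧ blk12 (WV θ) = 0 ∧ blk21 (WV θ) = 0 ∧
    blk12 (WKQ θ) = 0 ∧ blk21 (WKQ θ) = 0 ∧ blk22 (WKQ θ) = 0

end

end ICLAT

/-!
The flow is analysed in three steps.

*The off-blocks stay zero.* The law of the task weight `w` is symmetric. Replacing `w` by `-w` in
the integrands has the same effect as negating all entries of `θ` outside `w^V₂₂` and `W^KQ₁₁`, so
the loss is invariant under this linear isometry (`surrogateLoss_blockFlip`). The initialization is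
a fixed point, and by uniqueness of solutions so is the whole flow line
(`IsGradientFlow.apply_eq_of_symm`).

*The loss on the remaining blocks.* With `v = w^V₂₂`, `W = W^KQ₁₁` and `P = v W`, the Gaussian
moment formulas up to order four give the loss `2 (tr(Pᵀ A P Λ) - 2 tr(Λ P Λ) + tr Λ)`
(`surrogateLoss_of_offBlockZero`). Completing the square, this is `2 tr(Dᵀ A D Λ)` plus a constant,
where `D = P - A⁻¹ Λ` (`reducedLoss_eq`). The quadratic form `tr(Dᵀ A D Λ)` is positive definite in
`D`, so `A⁻¹ Λ` is the only minimizer.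

*Convergence.* The loss depends on `(v, W)` only through `v W`; invariance under the scaling
`(e^s v, e^{-s} W)` makes `v² - ‖W‖²` a conserved quantity (`balance_conserved`), and it vanishes
at the initialization. The bound on `σ` says that the initial loss is below the value `2 tr Λ` at
the saddle point `v = 0`, `W = 0` (`reducedLoss_init_lt`). As the loss does not increase, `v²` stays
above a positive constant (`exists_le_sq_of_loss_le`). There the loss satisfies a
Polyak–Łojasiewicz inequality (`exists_polyakLojasiewicz`), obtained by testing the gradient against
the direction `D` of `W`. Hence the excess loss decays exponentially and the flow line has finite
length, so it converges to a point of minimal loss (`IsGradientFlow.exists_tendsto`).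

Solutions exist for all time because the loss is nonnegative: the displacement up to time `T` is at
most `√(T L(θ(0)))`, so the flow on `[0, T]` stays in a ball and can be found by cutting the
gradient off outside a larger one (`exists_isGradientFlow`).
-/

namespace ICLAT

/-! ### Gradient flows -/

section GradientFlow

variable {E : Type*} [NormedAddCommGroup E] [InnerProductSpace ℝ E]

/-- If an energy `f` decays along a curve `γ` at rate at least `‖γ'‖²`, then the curve moves by at
most the square root of elapsed time times energy loss. -/
theorem sq_norm_sub_le_of_dissipation {γ γ' : ℝ → E} {f f' : ℝ → ℝ} {s t : ℝ} (hst : s ≤ t)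
    (hγ : ∀ x ∈ Icc s t, HasDerivWithinAt γ (γ' x) (Icc s t) x)
    (hf : ∀ x ∈ Icc s t, HasDerivWithinAt f (f' x) (Icc s t) x)
    (h : ∀ x ∈ Icc s t, f' x ≤ -‖γ' x‖ ^ 2) :
    ‖γ t - γ s‖ ^ 2 ≤ (t - s) * (f s - f t) := by
  rcases hst.eq_or_lt with rfl | hlt
  · simp
  set T := t - s with hT
  have hTpos : 0 < T := sub_pos.2 hlt
  set D := γ t - γ s with hD
  -- the derivative of this functional is at most `-‖T γ' - D‖²`; the claim is `φ t ≤ φ s`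
  let φ : ℝ → ℝ := fun x => 2 * T * inner ℝ D (γ x) + T ^ 2 * f x - x * ‖D‖ ^ 2
  have hφ : ∀ x ∈ Icc s t, HasDerivWithinAt φ
      (2 * T * inner ℝ D (γ' x) + T ^ 2 * f' x - ‖D‖ ^ 2) (Icc s t) x := by
    intro x hx
    have h1 : HasDerivWithinAt (fun x => inner ℝ D (γ x)) (inner ℝ D (γ' x)) (Icc s t) x := by
      simpa using (hasDerivWithinAt_const x (Icc s t) D).inner ℝ (hγ x hx)
    have h2 := ((h1.const_mul (2 * T)).add ((hf x hx).const_mul (T ^ 2))).sub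
      ((hasDerivWithinAt_id x (Icc s t)).mul_const (‖D‖ ^ 2))
    exact h2.congr_deriv (by ring)
  have hanti : AntitoneOn φ (Icc s t) := by
    refine antitoneOn_of_hasDerivWithinAt_nonpos (convex_Icc s t)
      (fun x hx => (hφ x hx).continuousWithinAt)
      (fun x hx => (hφ x (interior_subset hx)).mono interior_subset) ?_
    intro x hx
    have hx' := interior_subset hx
    have h3 : ‖T • γ' x - D‖ ^ 2 = T ^ 2 * ‖γ' x‖ ^ 2 - 2 * T * inner ℝ D (γ' x) + ‖D‖ ^ 2 := by
      rw [norm_sub_sq_real, norm_smul, real_inner_smul_left, real_inner_comm, mul_pow,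
        Real.norm_eq_abs, sq_abs]
      ring
    nlinarith [sq_nonneg ‖T • γ' x - D‖, mul_le_mul_of_nonneg_left (h x hx') (sq_nonneg T)]
  have h4 := hanti (left_mem_Icc.2 hst) (right_mem_Icc.2 hst) hst
  have h5 : inner ℝ D (γ t) - inner ℝ D (γ s) = ‖D‖ ^ 2 := by
    rw [← inner_sub_right, ← hD, real_inner_self_eq_norm_sq]
  simp only [φ] at h4
  have h6 : T * (‖D‖ ^ 2 + T * (f t - f s)) ≤ 0 := by
    have : t = s + T := by rw [hT]; ring
    nlinarith
  nlinarith [nonpos_of_mul_nonpos_right h6 hTpos]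

/-- Two integral curves of a locally Lipschitz vector field on `[0, T]` with the same start
agree. -/
theorem eqOn_Icc_of_hasDerivWithinAt {V : E → E} (hV : LocallyLipschitz V) {α β : ℝ → E} {T : ℝ}
    (hα : ∀ t ∈ Icc 0 T, HasDerivWithinAt α (V (α t)) (Icc 0 T) t)
    (hβ : ∀ t ∈ Icc 0 T, HasDerivWithinAt β (V (β t)) (Icc 0 T) t)
    (h0 : α 0 = β 0) : EqOn α β (Icc 0 T) := by
  have hαc : ContinuousOn α (Icc 0 T) := fun t ht => (hα t ht).continuousWithinAt
  have hβc : ContinuousOn β (Icc 0 T) := fun t ht => (hβ t ht).continuousWithinAt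
  -- on the compact union of the two curves the field is Lipschitz
  set S := α '' Icc 0 T ∪ β '' Icc 0 T
  have hS : IsCompact S := (isCompact_Icc.image_of_continuousOn hαc).union
    (isCompact_Icc.image_of_continuousOn hβc)
  obtain ⟨K, hK⟩ := (hV.locallyLipschitzOn (s := S)).exists_lipschitzOnWith_of_compact hS
  have aux : ∀ t ∈ Ico 0 T, Icc 0 T ∈ 𝓝[Ici t] t := fun t ht =>
    mem_of_superset (Icc_mem_nhdsGE ht.2) (Icc_subset_Icc_left ht.1)
  exact ODE_solution_unique_of_mem_Icc_right (v := fun _ => V) (s := fun _ => S)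
    (fun _ _ => hK) hαc
    (fun t ht => (hα t (Ico_subset_Icc_self ht)).mono_of_mem_nhdsWithin (aux t ht))
    (fun t ht => Or.inl (mem_image_of_mem _ (Ico_subset_Icc_self ht))) hβc
    (fun t ht => (hβ t (Ico_subset_Icc_self ht)).mono_of_mem_nhdsWithin (aux t ht))
    (fun t ht => Or.inr (mem_image_of_mem _ (Ico_subset_Icc_self ht))) h0

/-- A bounded locally Lipschitz vector field has integral curves on every interval `[0, T]`. -/
theorem exists_integralCurve_of_bounded [CompleteSpace E] [ProperSpace E] {V : E → E}
    (hV : LocallyLipschitz V) {C : ℝ} (hC : ∀ x, ‖V x‖ ≤ C) (x₀ : E) {T : ℝ} (hT : 0 ≤ T) :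
    ∃ α : ℝ → E, α 0 = x₀ ∧ ∀ t ∈ Icc 0 T, HasDerivWithinAt α (V (α t)) (Icc 0 T) t := by
  have hC0 : 0 ≤ C := (norm_nonneg _).trans (hC x₀)
  lift C to NNReal using hC0
  lift T to NNReal using hT
  obtain ⟨K, hK⟩ := (hV.locallyLipschitzOn
    (s := Metric.closedBall x₀ (C * T : NNReal))).exists_lipschitzOnWith_of_compact
      (isCompact_closedBall _ _)
  have hPL : IsPicardLindelof (fun _ => V) (tmin := 0) (tmax := T) ⟨0, le_rfl, T.2⟩ x₀
      (C * T) 0 C K :=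
    IsPicardLindelof.of_time_independent (fun x _ => hC x) hK (by simp)
  exact hPL.exists_eq_forall_mem_Icc_hasDerivWithinAt₀

variable [CompleteSpace E] {L : E → ℝ}

theorem hasGradientAt_gradient (hL : ContDiff ℝ 2 L) (x : E) :
    HasGradientAt L (gradient L x) x :=
  ((hL.differentiable (by norm_num)) x).hasGradientAt

theorem contDiff_gradient (hL : ContDiff ℝ 2 L) : ContDiff ℝ 1 (gradient L) :=
  (InnerProductSpace.toDual ℝ E).symm.contDiff.comp (hL.fderiv_right (by norm_num))

theorem hasDerivWithinAt_loss_comp (hL : ContDiff ℝ 2 L) {γ : ℝ → E} {v : E} {s : Set ℝ} {t : ℝ}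
    (hγ : HasDerivWithinAt γ v s t) :
    HasDerivWithinAt (fun x => L (γ x)) (inner ℝ (gradient L (γ t)) v) s t := by
  have h := (hasGradientAt_gradient hL (γ t)).hasFDerivAt.comp_hasDerivWithinAt t hγ
  rwa [InnerProductSpace.toDual_apply_apply] at h

/-- A nonnegative `C²` loss has gradient flow lines on every interval `[0, T]`. The flow is cut off
outside a ball of radius larger than `√(T L(x₀))`; the cut-off flow still dissipates the loss, hence
it never sees the cut-off. -/
theorem exists_gradientFlow_Icc [FiniteDimensional ℝ E] (hL : ContDiff ℝ 2 L)
    (hL0 : ∀ x, 0 ≤ L x) (x₀ : E) {T : ℝ} (hT : 0 ≤ T) :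
    ∃ α : ℝ → E, α 0 = x₀ ∧
      ∀ t ∈ Icc 0 T, HasDerivWithinAt α (-gradient L (α t)) (Icc 0 T) t := by
  set R : ℝ := Real.sqrt (T * L x₀) + 1 with hR
  have hRpos : 0 < R := by positivity
  let χ : ContDiffBump x₀ := ⟨R, R + 1, hRpos, by linarith⟩
  set V : E → E := fun x => χ x • (-gradient L x) with hVdef
  have hVc : ContDiff ℝ 1 V := χ.contDiff.smul (contDiff_gradient hL).neg
  have hVs : HasCompactSupport V := χ.hasCompactSupport.smul_right
  obtain ⟨C, hC⟩ := hVs.exists_bound_of_continuous hVc.continuous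
  obtain ⟨α, hα0, hα⟩ := exists_integralCurve_of_bounded hVc.locallyLipschitz hC x₀ hT
  refine ⟨α, hα0, fun t ht => ?_⟩
  have hmem : ‖α t - x₀‖ ≤ R := by
    have h1 : ‖α t - α 0‖ ^ 2 ≤ (t - 0) * (L (α 0) - L (α t)) := by
      have hsub : Icc 0 t ⊆ Icc 0 T := Icc_subset_Icc_right ht.2
      refine sq_norm_sub_le_of_dissipation (γ' := fun s => V (α s)) (f := fun s => L (α s))
        (f' := fun s => inner ℝ (gradient L (α s)) (V (α s))) ht.1
        (fun x hx => (hα x (hsub hx)).mono hsub)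
        (fun x hx => hasDerivWithinAt_loss_comp hL ((hα x (hsub hx)).mono hsub)) (fun x _ => ?_)
      · have hχ0 := χ.nonneg (x := α x)
        have hχ1 := χ.le_one (x := α x)
        simp only [hVdef, smul_neg, inner_neg_right, inner_smul_right, norm_neg, norm_smul,
          real_inner_self_eq_norm_sq, Real.norm_eq_abs, mul_pow, sq_abs]
        have : χ (α x) ^ 2 ≤ χ (α x) := by nlinarith
        nlinarith [mul_le_mul_of_nonneg_right this (sq_nonneg ‖gradient L (α x)‖)]
    rw [hα0] at h1
    have h2 : ‖α t - x₀‖ ^ 2 ≤ T * L x₀ := by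
      have ht1 := ht.1
      have ht2 := ht.2
      nlinarith [hL0 (α t), hL0 x₀, mul_nonneg ht1 (hL0 (α t)),
        mul_le_mul_of_nonneg_right ht2 (hL0 x₀)]
    have h3 := Real.le_sqrt_of_sq_le h2
    linarith
  have hχ : χ (α t) = 1 := χ.one_of_mem_closedBall (by simpa [dist_eq_norm] using hmem)
  have := hα t ht
  simpa only [hVdef, hχ, one_smul] using this

theorem isGradientFlow_iff (hL : ContDiff ℝ 2 L) {γ : ℝ → E} :
    IsGradientFlow L γ ↔
      ∀ t : ℝ, 0 ≤ t → HasDerivWithinAt γ (-gradient L (γ t)) (Ici 0) t := by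
  refine forall₂_congr fun t _ => ⟨?_, fun h => ⟨_, hasGradientAt_gradient hL _, h⟩⟩
  rintro ⟨g, hg, h⟩
  rwa [hg.gradient]

/-- Gradient flow lines of a `C²` loss are determined by their starting point. -/
theorem IsGradientFlow.eq_of_eq_zero (hL : ContDiff ℝ 2 L) {α β : ℝ → E}
    (hα : IsGradientFlow L α) (hβ : IsGradientFlow L β) (h0 : α 0 = β 0) {t : ℝ} (ht : 0 ≤ t) :
    α t = β t := by
  rw [isGradientFlow_iff hL] at hα hβ
  refine eqOn_Icc_of_hasDerivWithinAt (V := fun x => -gradient L x)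
    (contDiff_gradient hL).neg.locallyLipschitz
    (fun s hs => (hα s hs.1).mono Icc_subset_Ici_self)
    (fun s hs => (hβ s hs.1).mono Icc_subset_Ici_self) h0 (right_mem_Icc.2 ht)

/-- A nonnegative `C²` loss on a finite-dimensional space has a global forward gradient flow line
from every point. -/
theorem exists_isGradientFlow [FiniteDimensional ℝ E] (hL : ContDiff ℝ 2 L)
    (hL0 : ∀ x, 0 ≤ L x) (x₀ : E) : ∃ γ : ℝ → E, IsGradientFlow L γ ∧ γ 0 = x₀ := by
  choose α hα0 hα using fun n : ℕ => exists_gradientFlow_Icc hL hL0 x₀ (Nat.cast_nonneg (α := ℝ) n)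
  have hagree : ∀ m n : ℕ, m ≤ n → EqOn (α m) (α n) (Icc 0 (m : ℝ)) := by
    intro m n hmn
    have hsub : Icc 0 (m : ℝ) ⊆ Icc 0 (n : ℝ) := Icc_subset_Icc_right (by exact_mod_cast hmn)
    exact eqOn_Icc_of_hasDerivWithinAt (V := fun x => -gradient L x)
      (contDiff_gradient hL).neg.locallyLipschitz (hα m)
      (fun s hs => (hα n s (hsub hs)).mono hsub) (by rw [hα0, hα0])
  -- glue the solutions on the intervals `[0, n]`
  let γ : ℝ → E := fun t => α ⌈t⌉₊ t
  have hγ : ∀ n : ℕ, EqOn γ (α n) (Icc 0 (n : ℝ)) := fun n t ht =>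
    hagree _ n (Nat.ceil_le.2 ht.2) ⟨ht.1, Nat.le_ceil t⟩
  refine ⟨γ, (isGradientFlow_iff hL).2 fun t ht => ?_, by simp [γ, hα0]⟩
  obtain ⟨n, hn⟩ := exists_nat_gt t
  have htn : t ∈ Icc 0 (n : ℝ) := ⟨ht, hn.le⟩
  have h1 : HasDerivWithinAt γ (-gradient L (γ t)) (Icc 0 (n : ℝ)) t := by
    rw [hγ n htn]
    exact (hα n t htn).congr (hγ n) (hγ n htn)
  refine h1.mono_of_mem_nhdsWithin ?_
  rw [← Ici_inter_Iic]
  exact inter_mem_nhdsWithin _ (Iic_mem_nhds hn)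

/-- Along a gradient flow line, `‖γ(t) - γ(s)‖² ≤ (t - s) (L(γ(s)) - L(γ(t)))`. -/
theorem IsGradientFlow.sq_norm_sub_le (hL : ContDiff ℝ 2 L) {γ : ℝ → E}
    (hγ : IsGradientFlow L γ) {s t : ℝ} (hs : 0 ≤ s) (hst : s ≤ t) :
    ‖γ t - γ s‖ ^ 2 ≤ (t - s) * (L (γ s) - L (γ t)) := by
  rw [isGradientFlow_iff hL] at hγ
  have hsub : Icc s t ⊆ Ici 0 := fun x hx => hs.trans hx.1
  refine sq_norm_sub_le_of_dissipation (γ' := fun x => -gradient L (γ x)) (f := fun x => L (γ x))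
    (f' := fun x => inner ℝ (gradient L (γ x)) (-gradient L (γ x))) hst
    (fun x hx => (hγ x (hsub hx)).mono hsub)
    (fun x hx => hasDerivWithinAt_loss_comp hL ((hγ x (hsub hx)).mono hsub)) (fun x _ => ?_)
  simp

theorem IsGradientFlow.loss_antitone (hL : ContDiff ℝ 2 L) {γ : ℝ → E}
    (hγ : IsGradientFlow L γ) {s t : ℝ} (hs : 0 ≤ s) (hst : s ≤ t) : L (γ t) ≤ L (γ s) := by
  rcases hst.eq_or_lt with rfl | hlt
  · rfl
  have := (sq_nonneg _).trans (hγ.sq_norm_sub_le hL hs hst)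
  have := nonneg_of_mul_nonneg_right this (sub_pos.2 hlt)
  linarith

/-- Convergence under a Polyak–Łojasiewicz inequality: if `‖∇L‖² ≥ μ (L - c) ≥ 0` along a gradient
flow line, then the line converges and the loss converges to `c`. -/
theorem IsGradientFlow.exists_tendsto (hL : ContDiff ℝ 2 L) {γ : ℝ → E}
    (hγ : IsGradientFlow L γ) {μ c : ℝ} (hμ : 0 < μ) (hc : ∀ t, 0 ≤ t → c ≤ L (γ t))
    (hPL : ∀ t, 0 ≤ t → μ * (L (γ t) - c) ≤ ‖gradient L (γ t)‖ ^ 2) :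
    ∃ x, Tendsto γ atTop (𝓝 x) ∧ L x = c := by
  have hγ' := (isGradientFlow_iff hL).1 hγ
  -- exponential decay of the excess loss
  have hdecay : ∀ t, 0 ≤ t → L (γ t) - c ≤ Real.exp (-(μ * t)) * (L (γ 0) - c) := by
    let φ : ℝ → ℝ := fun t => Real.exp (μ * t) * (L (γ t) - c)
    have hφ : ∀ t ∈ Ici (0 : ℝ), HasDerivWithinAt φ
        (Real.exp (μ * t) * μ * (L (γ t) - c) +
          Real.exp (μ * t) * inner ℝ (gradient L (γ t)) (-gradient L (γ t))) (Ici 0) t := by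
      intro t ht
      have h1 := (hasDerivWithinAt_loss_comp hL (hγ' t ht)).sub_const c
      have h3 : HasDerivWithinAt (fun t => Real.exp (μ * t)) (Real.exp (μ * t) * μ) (Ici 0) t := by
        simpa using (((hasDerivAt_id t).const_mul μ).exp).hasDerivWithinAt
      exact h3.mul h1
    have hanti : AntitoneOn φ (Ici 0) := by
      refine antitoneOn_of_hasDerivWithinAt_nonpos (convex_Ici 0)
        (fun x hx => (hφ x hx).continuousWithinAt)
        (fun x hx => (hφ x (interior_subset hx)).mono interior_subset) ?_
      intro x hx
      have h4 := hPL x (interior_subset hx)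
      rw [inner_neg_right, real_inner_self_eq_norm_sq]
      nlinarith [mul_le_mul_of_nonneg_left h4 (Real.exp_pos (μ * x)).le]
    intro t ht
    have h5 := hanti self_mem_Ici ht ht
    simp only [φ, mul_zero, Real.exp_zero, one_mul] at h5
    rw [Real.exp_neg, ← div_eq_inv_mul, le_div_iff₀ (Real.exp_pos _)]
    linarith
  set F := L (γ 0) - c with hF
  have hF0 : 0 ≤ F := sub_nonneg.2 (hc 0 le_rfl)
  set r := Real.exp (-(μ / 2)) with hr
  have hr1 : r < 1 := by rw [hr, Real.exp_lt_one_iff]; linarith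
  have hr0 : 0 ≤ r := (Real.exp_pos _).le
  -- displacement over a unit of time after the `n`th
  have hstep : ∀ n : ℕ, ∀ t, (n : ℝ) ≤ t → t ≤ n + 1 → ‖γ t - γ n‖ ≤ Real.sqrt F * r ^ n := by
    intro n t h1 h2
    have hn : (0 : ℝ) ≤ n := Nat.cast_nonneg n
    have h3 := hγ.sq_norm_sub_le hL hn h1
    have h4 := hdecay n hn
    have h5 := hc t (hn.trans h1)
    have h6 := hγ.loss_antitone hL hn h1
    have h7 : ‖γ t - γ n‖ ^ 2 ≤ Real.exp (-(μ * n)) * F := by nlinarith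
    have h8 : Real.exp (-(μ * n)) = (r ^ n) ^ 2 := by
      rw [hr, ← Real.exp_nat_mul, ← Real.exp_nat_mul]
      congr 1
      push_cast
      ring
    rw [h8] at h7
    have h9 := Real.abs_le_sqrt h7
    rw [abs_norm, Real.sqrt_mul (by positivity), Real.sqrt_sq (by positivity)] at h9
    linarith
  have hcauchy : CauchySeq (fun n : ℕ => γ n) := by
    refine cauchySeq_of_le_geometric r (Real.sqrt F) hr1 fun n => ?_
    have := hstep n (n + 1) (by linarith) le_rfl
    rw [dist_comm, dist_eq_norm]
    push_cast
    exact this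
  obtain ⟨x, hx⟩ := cauchySeq_tendsto_of_complete hcauchy
  have hfloor : Tendsto (fun t : ℝ => ⌊t⌋₊) atTop atTop := tendsto_nat_floor_atTop
  have hlim : Tendsto γ atTop (𝓝 x) := by
    have h1 : Tendsto (fun t : ℝ => γ (⌊t⌋₊ : ℝ)) atTop (𝓝 x) := hx.comp hfloor
    have h2 : Tendsto (fun t : ℝ => γ t - γ (⌊t⌋₊ : ℝ)) atTop (𝓝 0) := by
      have h3 : Tendsto (fun t : ℝ => Real.sqrt F * r ^ ⌊t⌋₊) atTop (𝓝 0) := by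
        simpa using ((tendsto_pow_atTop_nhds_zero_of_lt_one hr0 hr1).comp hfloor).const_mul
          (Real.sqrt F)
      refine squeeze_zero_norm' ?_ h3
      filter_upwards [eventually_ge_atTop 0] with t ht
      exact hstep _ t (Nat.floor_le ht) (Nat.lt_floor_add_one t).le
    simpa using h2.add h1
  refine ⟨x, hlim, ?_⟩
  have h1 : Tendsto (fun t => L (γ t)) atTop (𝓝 (L x)) :=
    (hL.continuous.tendsto x).comp hlim
  have h2 : Tendsto (fun t => L (γ t) - c) atTop (𝓝 0) := by
    have h3 : Tendsto (fun t : ℝ => Real.exp (-(μ * t)) * F) atTop (𝓝 0) := by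
      have : Tendsto (fun t : ℝ => -(μ * t)) atTop atBot :=
        tendsto_neg_atTop_atBot.comp (tendsto_id.const_mul_atTop hμ)
      simpa using (Real.tendsto_exp_atBot.comp this).mul_const F
    refine squeeze_zero' ?_ ?_ h3
    · filter_upwards [eventually_ge_atTop 0] with t ht using sub_nonneg.2 (hc t ht)
    · filter_upwards [eventually_ge_atTop 0] with t ht using hdecay t ht
  have h3 := tendsto_nhds_unique h2 (h1.sub_const c)
  linarith

/-- A gradient flow line started at a fixed point of a linear isometric symmetry of the loss
consists of fixed points. -/
theorem IsGradientFlow.apply_eq_of_symm (hL : ContDiff ℝ 2 L) {γ : ℝ → E}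
    (hγ : IsGradientFlow L γ) (S : E ≃ₗᵢ[ℝ] E) (hS : ∀ x, L (S x) = L x) (h0 : S (γ 0) = γ 0)
    {t : ℝ} (ht : 0 ≤ t) : S (γ t) = γ t := by
  refine IsGradientFlow.eq_of_eq_zero (α := fun t => S (γ t)) hL ?_ hγ h0 ht
  intro t ht
  obtain ⟨g, hg, hd⟩ := hγ t ht
  refine ⟨S g, ?_, ?_⟩
  · have h1 : L = L ∘ S.symm := by
      funext x
      simpa using hS (S.symm x)
    rw [hasGradientAt_iff_hasFDerivAt] at hg ⊢
    have h2 : HasFDerivAt (L ∘ S.symm)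
        ((InnerProductSpace.toDual ℝ E g).comp (S.symm.toContinuousLinearEquiv : E →L[ℝ] E))
        (S (γ t)) := by
      refine HasFDerivAt.comp _ ?_ S.symm.toContinuousLinearEquiv.hasFDerivAt
      simpa using hg
    rw [← h1] at h2
    have h3 : InnerProductSpace.toDual ℝ E (S g) =
        (InnerProductSpace.toDual ℝ E g).comp (S.symm.toContinuousLinearEquiv : E →L[ℝ] E) := by
      ext y
      simpa using (S.inner_map_map g (S.symm y))
    rwa [h3]
  · have := (S.toContinuousLinearEquiv : E →L[ℝ] E).hasFDerivAt.comp_hasDerivWithinAt t hd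
    simpa [Function.comp_def] using this

end GradientFlow

/-! ### Random variables with all moments -/

section Moments

variable {Ω Ω' : Type*} [MeasurableSpace Ω] [MeasurableSpace Ω'] {μ : Measure Ω} {ν : Measure Ω'}

/-- A random variable with finite absolute moments of all orders. -/
def HasMoments (μ : Measure Ω) (f : Ω → ℝ) : Prop := ∀ p : NNReal, MemLp f p μ

theorem HasMoments.add {f g : Ω → ℝ} (hf : HasMoments μ f) (hg : HasMoments μ g) :
    HasMoments μ (fun x => f x + g x) := fun p => (hf p).add (hg p)

theorem HasMoments.sub {f g : Ω → ℝ} (hf : HasMoments μ f) (hg : HasMoments μ g) :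
    HasMoments μ (fun x => f x - g x) := fun p => (hf p).sub (hg p)

theorem HasMoments.mul {f g : Ω → ℝ} (hf : HasMoments μ f) (hg : HasMoments μ g) :
    HasMoments μ (fun x => f x * g x) := fun p => by
  have : ENNReal.HolderTriple ((2 * p : NNReal) : ENNReal) ((2 * p : NNReal) : ENNReal) p :=
    ⟨by
      rw [ENNReal.coe_mul, ENNReal.mul_inv (by simp) (by simp), ← add_mul]
      simp [ENNReal.inv_two_add_inv_two]⟩
  exact (hg (2 * p)).mul' (hf (2 * p))

theorem hasMoments_const [IsFiniteMeasure μ] (c : ℝ) : HasMoments μ (fun _ => c) :=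
  fun _ => memLp_const c

theorem HasMoments.const_mul {f : Ω → ℝ} (hf : HasMoments μ f) (c : ℝ) :
    HasMoments μ (fun x => c * f x) := fun p => (hf p).const_mul c

theorem HasMoments.sum {ι : Type*} {s : Finset ι} {f : ι → Ω → ℝ}
    (hf : ∀ i ∈ s, HasMoments μ (f i)) : HasMoments μ (fun x => ∑ i ∈ s, f i x) := fun p =>
  memLp_finsetSum s fun i hi => hf i hi p

theorem HasMoments.dotProduct {ι : Type*} [Fintype ι] {u v : Ω → ι → ℝ}
    (hu : ∀ i, HasMoments μ (fun x => u x i)) (hv : ∀ i, HasMoments μ (fun x => v x i)) :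
    HasMoments μ (fun x => u x ⬝ᵥ v x) := HasMoments.sum fun i _ => (hu i).mul (hv i)

theorem HasMoments.matrix_mul {l m n : Type*} [Fintype m] {A : Ω → Matrix l m ℝ}
    {B : Ω → Matrix m n ℝ} (hA : ∀ i j, HasMoments μ (fun x => A x i j))
    (hB : ∀ i j, HasMoments μ (fun x => B x i j)) (i : l) (j : n) :
    HasMoments μ (fun x => (A x * B x) i j) :=
  HasMoments.dotProduct (u := fun x => A x i) (v := fun x k => B x k j) (hA i) fun k => hB k j

theorem HasMoments.integrable {f : Ω → ℝ} (hf : HasMoments μ f) : Integrable f μ :=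
  memLp_one_iff_integrable.1 (by simpa using hf 1)

theorem HasMoments.comp {f : Ω' → ℝ} (hf : HasMoments ν f) {φ : Ω → Ω'}
    (hφ : MeasurePreserving φ μ ν) : HasMoments μ (fun x => f (φ x)) := fun p =>
  (hf p).comp_measurePreserving hφ

/-- A family `F θ` of random variables which is a finite sum of terms `m θ * f`, with `m` smooth and
`f` having moments of all orders. Polynomials in `θ` and in Gaussian vectors are of this kind, and
such families can be integrated term by term. -/
def SmoothMoments {E : Type*} [NormedAddCommGroup E] [NormedSpace ℝ E] (μ : Measure Ω)
    (F : E → Ω → ℝ) : Prop :=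
  ∃ (ι : Type) (_ : Fintype ι) (m : ι → E → ℝ) (f : ι → Ω → ℝ),
    (∀ i, ContDiff ℝ 2 (m i)) ∧ (∀ i, HasMoments μ (f i)) ∧ ∀ θ x, F θ x = ∑ i, m i θ * f i x

variable {E : Type*} [NormedAddCommGroup E] [NormedSpace ℝ E]

theorem smoothMoments_of_contDiff [IsFiniteMeasure μ] {m : E → ℝ} (hm : ContDiff ℝ 2 m) :
    SmoothMoments μ (fun θ (_ : Ω) => m θ) :=
  ⟨Unit, inferInstance, fun _ => m, fun _ _ => 1, fun _ => hm, fun _ => hasMoments_const 1,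
    fun _ _ => by simp⟩

theorem HasMoments.smoothMoments {f : Ω → ℝ} (hf : HasMoments μ f) :
    SmoothMoments μ (fun (_ : E) x => f x) :=
  ⟨Unit, inferInstance, fun _ _ => 1, fun _ => f, fun _ => contDiff_const, fun _ => hf,
    fun _ _ => by simp⟩

theorem SmoothMoments.add {F G : E → Ω → ℝ} (hF : SmoothMoments μ F) (hG : SmoothMoments μ G) :
    SmoothMoments μ (fun θ x => F θ x + G θ x) := by
  obtain ⟨ι, _, m, f, hm, hf, hFe⟩ := hF
  obtain ⟨κ, _, n, g, hn, hg, hGe⟩ := hG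
  refine ⟨ι ⊕ κ, inferInstance, Sum.elim m n, Sum.elim f g, ?_, ?_, fun θ x => ?_⟩
  · rintro (i | i) <;> simp [hm, hn]
  · rintro (i | i) <;> simp [hf, hg]
  · simp [hFe, hGe]

theorem SmoothMoments.mul {F G : E → Ω → ℝ} (hF : SmoothMoments μ F) (hG : SmoothMoments μ G) :
    SmoothMoments μ (fun θ x => F θ x * G θ x) := by
  obtain ⟨ι, _, m, f, hm, hf, hFe⟩ := hF
  obtain ⟨κ, _, n, g, hn, hg, hGe⟩ := hG
  refine ⟨ι × κ, inferInstance, fun i θ => m i.1 θ * n i.2 θ, fun i x => f i.1 x * g i.2 x,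
    fun i => (hm _).mul (hn _), fun i => (hf _).mul (hg _), fun θ x => ?_⟩
  simp only [hFe, hGe]
  rw [Finset.sum_mul_sum, Fintype.sum_prod_type]
  exact Finset.sum_congr rfl fun i _ => Finset.sum_congr rfl fun j _ => by ring

theorem SmoothMoments.sub {F G : E → Ω → ℝ} [IsFiniteMeasure μ] (hF : SmoothMoments μ F)
    (hG : SmoothMoments μ G) : SmoothMoments μ (fun θ x => F θ x - G θ x) := by
  have := hF.add ((smoothMoments_of_contDiff (E := E) (m := fun _ => -1) contDiff_const).mul hG)
  simpa [sub_eq_add_neg] using this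

theorem SmoothMoments.sum [IsFiniteMeasure μ] {ι : Type*} {s : Finset ι} {F : ι → E → Ω → ℝ}
    (hF : ∀ i ∈ s, SmoothMoments μ (F i)) : SmoothMoments μ (fun θ x => ∑ i ∈ s, F i θ x) := by
  classical
  induction s using Finset.induction_on with
  | empty =>
    simpa using smoothMoments_of_contDiff (μ := μ) (E := E) (m := fun _ => 0) contDiff_const
  | insert a s ha ih =>
    simp only [Finset.sum_insert ha]
    exact (hF a (Finset.mem_insert_self a s)).add
      (ih fun i hi => hF i (Finset.mem_insert_of_mem hi))

theorem SmoothMoments.dotProduct [IsFiniteMeasure μ] {ι : Type*} [Fintype ι] {u v : E → Ω → ι → ℝ}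
    (hu : ∀ i, SmoothMoments μ (fun θ x => u θ x i))
    (hv : ∀ i, SmoothMoments μ (fun θ x => v θ x i)) :
    SmoothMoments μ (fun θ x => u θ x ⬝ᵥ v θ x) := SmoothMoments.sum fun i _ => (hu i).mul (hv i)

theorem SmoothMoments.sq {F : E → Ω → ℝ} (hF : SmoothMoments μ F) :
    SmoothMoments μ (fun θ x => F θ x ^ 2) := by
  simp only [pow_two]
  exact hF.mul hF

theorem SmoothMoments.contDiff_integral {F : E → Ω → ℝ} (hF : SmoothMoments μ F) :
    ContDiff ℝ 2 (fun θ => ∫ x, F θ x ∂μ) := by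
  obtain ⟨ι, _, m, f, hm, hf, hFe⟩ := hF
  have : (fun θ => ∫ x, F θ x ∂μ) = fun θ => ∑ i, m i θ * ∫ x, f i x ∂μ := by
    funext θ
    simp only [hFe]
    rw [integral_finsetSum _ fun i _ => ((hf i).const_mul _).integrable]
    simp only [integral_const_mul]
  rw [this]
  exact ContDiff.sum fun i _ => (hm i).mul contDiff_const

end Moments

/-! ### Fourth moments of Gaussian vectors -/

section Gaussian

/-- The fourth moment of a centered real Gaussian, from the fourth derivative of its moment
generating function. -/
theorem integral_pow_four_gaussianReal (v : NNReal) :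
    ∫ y, y ^ 4 ∂(gaussianReal 0 v) = 3 * (v : ℝ) ^ 2 := by
  have h0 := iteratedDeriv_mgf_zero (X := id) (μ := gaussianReal 0 v)
    (by simp [integrableExpSet_id_gaussianReal]) 4
  have hf : ∀ (p p' : ℝ → ℝ), (∀ t, HasDerivAt p (p' t) t) →
      deriv (fun t => p t * Real.exp (0 * t + v * t ^ 2 / 2)) =
        fun t => (p' t + v * t * p t) * Real.exp (0 * t + v * t ^ 2 / 2) := by
    intro p p' hp
    funext t
    have h1 : HasDerivAt (fun t : ℝ => 0 * t + v * t ^ 2 / 2) (v * t) t := by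
      have := ((hasDerivAt_id t).const_mul (0 : ℝ)).add
        ((((hasDerivAt_id t).pow 2).const_mul (v : ℝ)).div_const 2)
      refine this.congr_deriv ?_
      simp
      ring
    refine ((hp t).mul h1.exp).deriv.trans ?_
    ring
  have e0 : mgf id (gaussianReal 0 v) = fun t => (1 : ℝ) * Real.exp (0 * t + v * t ^ 2 / 2) := by
    rw [mgf_id_gaussianReal]; simp
  have e1 := hf (fun _ => 1) (fun _ => 0) fun t => hasDerivAt_const t 1
  have e2 := hf (fun t => 0 + v * t * 1) (fun _ => v) fun t => by
    simpa using (hasDerivAt_id t).const_mul (v : ℝ)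
  have e3 := hf (fun t => v + v * t * (0 + v * t * 1)) (fun t => 2 * v ^ 2 * t) fun t => by
    have h := (((hasDerivAt_id t).pow 2).const_mul ((v : ℝ) ^ 2)).const_add (v : ℝ)
    have h' := h.congr_deriv (show _ = 2 * (v : ℝ) ^ 2 * t by simp; ring)
    refine h'.congr_of_eventuallyEq (Eventually.of_forall fun s => ?_)
    simp
    ring
  have e4 := hf (fun t => 2 * v ^ 2 * t + v * t * (v + v * t * (0 + v * t * 1)))
    (fun t => 3 * v ^ 2 + 3 * v ^ 3 * t ^ 2) fun t => by
    have h := ((hasDerivAt_id t).const_mul (3 * (v : ℝ) ^ 2)).add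
      (((hasDerivAt_id t).pow 3).const_mul ((v : ℝ) ^ 3))
    have h' := h.congr_deriv (show _ = 3 * (v : ℝ) ^ 2 + 3 * v ^ 3 * t ^ 2 by simp; ring)
    refine h'.congr_of_eventuallyEq (Eventually.of_forall fun s => ?_)
    simp
    ring
  rw [e0, iteratedDeriv_succ', e1, iteratedDeriv_succ', e2, iteratedDeriv_succ', e3,
    iteratedDeriv_succ', e4, iteratedDeriv_zero] at h0
  simpa using h0.symm

variable {F : Type*} [NormedAddCommGroup F] [NormedSpace ℝ F] [MeasurableSpace F] [BorelSpace F]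

theorem hasMoments_dual (μ : Measure F) [IsGaussian μ] (l : StrongDual ℝ F) :
    HasMoments μ (fun x => l x) := fun p => IsGaussian.memLp_dual μ l p (by simp)

variable [SecondCountableTopology F] [CompleteSpace F] {μ : Measure F} [IsGaussian μ]

theorem integral_dual_pow_four (hμ : ∫ x, x ∂μ = 0) (l : StrongDual ℝ F) :
    ∫ x, l x ^ 4 ∂μ = 3 * (∫ x, l x * l x ∂μ) ^ 2 := by
  have h0 : μ[l] = 0 := by rw [IsGaussian.integral_dual, hμ, map_zero]
  have h1 := IsGaussian.map_eq_gaussianReal (μ := μ) l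
  have h2 : ∫ y, y ^ 4 ∂(μ.map l) = ∫ x, l x ^ 4 ∂μ :=
    integral_map (by fun_prop) (by fun_prop)
  rw [← h2, h1, h0, integral_pow_four_gaussianReal, Real.coe_toNNReal _ (variance_nonneg _ _),
    variance_of_integral_eq_zero (by fun_prop) h0]
  simp only [pow_two]

/-- Isserlis' formula for `E[a b c²]`, by polarization of `E[l⁴] = 3 E[l²]²`. -/
theorem integral_mul_mul_sq_of_isGaussian (hμ : ∫ x, x ∂μ = 0) (a b c : StrongDual ℝ F) :
    ∫ x, a x * b x * c x ^ 2 ∂μ = (∫ x, a x * b x ∂μ) * (∫ x, c x * c x ∂μ)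
      + 2 * (∫ x, a x * c x ∂μ) * (∫ x, b x * c x ∂μ) := by
  have hB : ∀ l l' : StrongDual ℝ F,
      ∫ x, l x * l' x ∂μ = uncenteredCovarianceBilinDual μ l l' := fun l l' =>
    (uncenteredCovarianceBilinDual_apply IsGaussian.memLp_two_id l l').symm
  have h4 : ∀ l : StrongDual ℝ F,
      ∫ x, l x ^ 4 ∂μ = 3 * (uncenteredCovarianceBilinDual μ l l) ^ 2 := fun l => by
    rw [integral_dual_pow_four hμ, hB]
  have hsymm : ∀ l l' : StrongDual ℝ F,
      uncenteredCovarianceBilinDual μ l l' = uncenteredCovarianceBilinDual μ l' l := fun l l' => by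
    rw [← hB, ← hB]; simp only [mul_comm]
  have hI : ∀ l : StrongDual ℝ F, Integrable (fun x => l x ^ 4) μ := fun l => by
    have h := hasMoments_dual μ l
    have := ((h.mul h).mul (h.mul h)).integrable
    refine this.congr (Eventually.of_forall fun x => ?_)
    ring
  -- the second difference in `c` of `(a ± b)⁴` is `12 (a ± b)² c² + 2 c⁴`
  have hpt : ∀ x, a x * b x * c x ^ 2 = (1 / 48) * (((a + b + c) x ^ 4 + (a + b - c) x ^ 4
      - 2 * (a + b) x ^ 4) - ((a - b + c) x ^ 4 + (a - b - c) x ^ 4 - 2 * (a - b) x ^ 4)) := by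
    intro x
    simp only [_root_.add_apply, _root_.sub_apply]
    ring
  simp_rw [hpt]
  have hJ : ∀ l₁ l₂ l₃ : StrongDual ℝ F,
      Integrable (fun x => l₁ x ^ 4 + l₂ x ^ 4 - 2 * l₃ x ^ 4) μ := fun l₁ l₂ l₃ =>
    ((hI l₁).add (hI l₂)).sub ((hI l₃).const_mul 2)
  have hK : ∀ l₁ l₂ l₃ : StrongDual ℝ F, ∫ x, (l₁ x ^ 4 + l₂ x ^ 4 - 2 * l₃ x ^ 4) ∂μ =
      ∫ x, l₁ x ^ 4 ∂μ + ∫ x, l₂ x ^ 4 ∂μ - 2 * ∫ x, l₃ x ^ 4 ∂μ := fun l₁ l₂ l₃ => by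
    rw [integral_sub _ ((hI l₃).const_mul 2), integral_add (hI l₁) (hI l₂), integral_const_mul]
    exact (hI l₁).add (hI l₂)
  rw [integral_const_mul, integral_sub (hJ _ _ _) (hJ _ _ _), hK, hK]
  simp only [h4, hB]
  simp only [map_add, map_sub, _root_.add_apply, _root_.sub_apply]
  rw [hsymm b a, hsymm c a, hsymm c b]
  ring

variable {d : ℕ} {Λ : Matrix (Fin d) (Fin d) ℝ}

theorem hasMoments_eval (i : Fin d) :
    HasMoments (multivariateGaussian 0 Λ) (fun x : EuclideanSpace ℝ (Fin d) => x i) :=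
  hasMoments_dual _ (EuclideanSpace.proj i)

theorem integral_eval_mul_eval (hΛ : Λ.PosSemidef) (i j : Fin d) :
    ∫ x, x i * x j ∂(multivariateGaussian 0 Λ) = Λ i j := by
  rw [← covariance_eval_multivariateGaussian (μ := 0) hΛ i j,
    covariance_eq_sub (hasMoments_eval i 2) (hasMoments_eval j 2)]
  have h : ∀ k : Fin d, ∫ x, x k ∂(multivariateGaussian 0 Λ) = 0 := fun k => by
    have := IsGaussian.integral_dual (μ := multivariateGaussian 0 Λ) (EuclideanSpace.proj k)
    simpa using this
  simp [h]

/-- The expectation of `xᵢ xⱼ ‖x‖²` for a centered Gaussian vector `x`. -/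
theorem integral_eval_mul_eval_mul_sum_sq (hΛ : Λ.PosSemidef) (i j : Fin d) :
    ∫ x, ∑ k, x i * x j * x k ^ 2 ∂(multivariateGaussian 0 Λ) =
      Λ.trace * Λ i j + 2 * (Λ * Λ) i j := by
  have hs : ∀ i j, Λ i j = Λ j i := fun i j => by simpa using hΛ.isHermitian.apply j i
  rw [integral_finsetSum]
  · have h := fun k => integral_mul_mul_sq_of_isGaussian (μ := multivariateGaussian 0 Λ)
      (by simp) (EuclideanSpace.proj (𝕜 := ℝ) i) (EuclideanSpace.proj j) (EuclideanSpace.proj k)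
    simp only [PiLp.proj_apply, integral_eval_mul_eval hΛ] at h
    simp only [h, Finset.sum_add_distrib, Matrix.trace, Matrix.diag, Matrix.mul_apply,
      Finset.sum_mul, Finset.mul_sum]
    congr 1
    · exact Finset.sum_congr rfl fun k _ => mul_comm _ _
    · exact Finset.sum_congr rfl fun k _ => by rw [hs j k]; ring
  · intro k _
    have := (((hasMoments_eval (Λ := Λ) i).mul (hasMoments_eval j)).mul
      ((hasMoments_eval k).mul (hasMoments_eval k))).integrable
    simpa only [pow_two] using this

end Gaussian

/-! ### Smoothness of the surrogate loss -/

section TaskMoments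

variable {d N M : ℕ} {Λ : Matrix (Fin d) (Fin d) ℝ}

instance isProbabilityMeasure_taskLaw : IsProbabilityMeasure (taskLaw Λ N M) := by
  unfold taskLaw
  infer_instance

theorem hasMoments_w (i : Fin d) :
    HasMoments (taskLaw Λ N M) (fun τ : Task d N M => Task.w τ i) :=
  (hasMoments_eval (Λ := 1) i).comp measurePreserving_fst

theorem hasMoments_pi_eval {n : ℕ} (i : Fin d) (m : Fin n) :
    HasMoments (Measure.pi fun _ : Fin n => multivariateGaussian 0 Λ)
      (fun x : Fin n → EuclideanSpace ℝ (Fin d) => x m i) :=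
  (hasMoments_eval (Λ := Λ) i).comp (measurePreserving_eval _ m)

theorem hasMoments_X (i : Fin d) (n : Fin N) :
    HasMoments (taskLaw Λ N M) (fun τ : Task d N M => Task.X τ i n) :=
  (hasMoments_pi_eval (Λ := Λ) i n).comp (measurePreserving_fst.comp measurePreserving_snd)

theorem hasMoments_Xsfx (i : Fin d) (m : Fin M) :
    HasMoments (taskLaw Λ N M) (fun τ : Task d N M => Task.Xsfx τ i m) :=
  (hasMoments_pi_eval (Λ := Λ) i m).comp
    (measurePreserving_fst.comp (measurePreserving_snd.comp measurePreserving_snd))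

theorem hasMoments_xq (i : Fin d) :
    HasMoments (taskLaw Λ N M) (fun τ : Task d N M => Task.xq τ i) :=
  (hasMoments_eval (Λ := Λ) i).comp
    (measurePreserving_snd.comp (measurePreserving_snd.comp measurePreserving_snd))

theorem hasMoments_yq : HasMoments (taskLaw Λ N M) (fun τ : Task d N M => Task.yq τ) :=
  HasMoments.dotProduct hasMoments_w hasMoments_xq

theorem hasMoments_withLabels {n : ℕ} {X : Task d N M → Matrix (Fin d) (Fin n) ℝ}
    (hX : ∀ i a, HasMoments (taskLaw Λ N M) (fun τ => X τ i a)) (i : Idx d) (a : Fin n) :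
    HasMoments (taskLaw Λ N M) (fun τ : Task d N M => withLabels (Task.w τ) (X τ) i a) := by
  rcases i with i | i
  · exact hX i a
  · exact HasMoments.dotProduct hasMoments_w fun k => hX k a

theorem hasMoments_sfx (i : Idx d) (a : Fin M) :
    HasMoments (taskLaw Λ N M) (fun τ : Task d N M => Task.sfx τ i a) :=
  hasMoments_withLabels hasMoments_Xsfx i a

theorem hasMoments_Eclean (i : Idx d) (a : (Fin N ⊕ Fin M) ⊕ Unit) :
    HasMoments (taskLaw Λ N M) (fun τ : Task d N M => Task.Eclean τ i a) := by
  rcases a with (a | a) | a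
  · exact hasMoments_withLabels hasMoments_X i a
  · exact hasMoments_sfx i a
  · rcases i with i | i
    · exact hasMoments_xq i
    · exact hasMoments_const 0

theorem contDiff_valRow (i : Idx d) : ContDiff ℝ 2 (fun θ : Param d => valRow θ i) := by
  rcases i with i | i <;>
    simp only [valRow, blk21, blk22, WV, Sum.elim_inl, Sum.elim_inr, Matrix.of_apply] <;> fun_prop

theorem contDiff_kqCols (i : Idx d) (j : Fin d) :
    ContDiff ℝ 2 (fun θ : Param d => kqCols θ i j) := by
  rcases i with i | i
  · change ContDiff ℝ 2 (fun θ : Param d => θ (Sum.inr (Sum.inl i, Sum.inl j)))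
    fun_prop
  · change ContDiff ℝ 2 (fun θ : Param d => θ (Sum.inr (Sum.inr (), Sum.inl j)))
    fun_prop

theorem contDiff_sqNorm_blk21_WV : ContDiff ℝ 2 (fun θ : Param d => sqNorm (blk21 (WV θ))) :=
  ContDiff.sum fun i _ => (contDiff_valRow (Sum.inl i)).pow 2

theorem smoothMoments_kqCols_mulVec (i : Idx d) :
    SmoothMoments (taskLaw Λ N M)
      (fun θ (τ : Task d N M) => (kqCols θ *ᵥ Task.xq τ) i) :=
  SmoothMoments.dotProduct (fun j => smoothMoments_of_contDiff (contDiff_kqCols i j))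
    fun j => (hasMoments_xq j).smoothMoments

theorem smoothMoments_sqNorm_blk11_mulVec :
    SmoothMoments (taskLaw Λ N M)
      (fun θ (τ : Task d N M) => sqNorm (blk11 (WKQ θ) *ᵥ Task.xq τ)) :=
  SmoothMoments.sum fun i _ => (smoothMoments_kqCols_mulVec (Sum.inl i)).sq

theorem smoothMoments_loss1 :
    SmoothMoments (taskLaw Λ N M) (fun θ (τ : Task d N M) =>
      (valRow θ ⬝ᵥ
        (((1 / ((N : ℝ) + M)) • (Task.Eclean τ * (Task.Eclean τ)ᵀ)) *ᵥ (kqCols θ *ᵥ Task.xq τ))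
        - Task.yq τ) ^ 2) := by
  refine (SmoothMoments.sub (SmoothMoments.dotProduct
    (fun i => smoothMoments_of_contDiff (contDiff_valRow i)) fun i => SmoothMoments.dotProduct
      (fun j => HasMoments.smoothMoments ?_) smoothMoments_kqCols_mulVec)
    hasMoments_yq.smoothMoments).sq
  exact HasMoments.const_mul
    (HasMoments.dotProduct (hasMoments_Eclean i) (hasMoments_Eclean j)) _

theorem smoothMoments_loss3 :
    SmoothMoments (taskLaw Λ N M) (fun θ (τ : Task d N M) =>
      sqNorm (blk11 (WKQ θ) *ᵥ Task.xq τ) * sqNorm (valRow θ ᵥ* Task.sfx τ)) :=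
  smoothMoments_sqNorm_blk11_mulVec.mul <| SmoothMoments.sum fun a _ =>
    SmoothMoments.sq <| SmoothMoments.dotProduct
      (fun i => smoothMoments_of_contDiff (contDiff_valRow i))
      fun i => (hasMoments_sfx i a).smoothMoments

theorem smoothMoments_loss4 :
    SmoothMoments (taskLaw Λ N M) (fun θ (τ : Task d N M) =>
      sqNorm ((Task.sfx τ)ᵀ *ᵥ (kqCols θ *ᵥ Task.xq τ))) :=
  SmoothMoments.sum fun a _ => SmoothMoments.sq <| SmoothMoments.dotProduct
    (fun i => (hasMoments_sfx i a).smoothMoments) smoothMoments_kqCols_mulVec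

variable (N M Λ)

/-- The surrogate loss is smooth: its integrands are polynomials in the parameters and in Gaussian
vectors. -/
theorem contDiff_surrogateLoss (ε : ℝ) : ContDiff ℝ 2 (surrogateLoss Λ N M ε) := by
  refine (((contDiff_const.mul smoothMoments_loss1.contDiff_integral).add ?_).add
    (contDiff_const.mul smoothMoments_loss3.contDiff_integral)).add ?_
  · exact (contDiff_const.mul contDiff_sqNorm_blk21_WV).mul
      smoothMoments_sqNorm_blk11_mulVec.contDiff_integral
  · exact (contDiff_const.mul contDiff_sqNorm_blk21_WV).mul
      smoothMoments_loss4.contDiff_integral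

theorem sqNorm_nonneg {ι : Type*} [Fintype ι] (v : ι → ℝ) : 0 ≤ sqNorm v :=
  Finset.sum_nonneg fun _ _ => sq_nonneg _

theorem surrogateLoss_nonneg (ε : ℝ) (θ : Param d) : 0 ≤ surrogateLoss Λ N M ε θ := by
  have h1 : 0 ≤ loss1 Λ N M θ :=
    mul_nonneg two_pos.le (integral_nonneg fun _ => sq_nonneg _)
  have h2 : 0 ≤ loss2 Λ N M ε θ := by
    refine mul_nonneg (mul_nonneg ?_ (sqNorm_nonneg _)) (integral_nonneg fun _ => sqNorm_nonneg _)
    positivity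
  have h3 : 0 ≤ loss3 Λ N M ε θ := by
    refine mul_nonneg ?_
      (integral_nonneg fun _ => mul_nonneg (sqNorm_nonneg _) (sqNorm_nonneg _))
    positivity
  have h4 : 0 ≤ loss4 Λ N M ε θ := by
    refine mul_nonneg (mul_nonneg ?_ (sqNorm_nonneg _)) (integral_nonneg fun _ => sqNorm_nonneg _)
    positivity
  unfold surrogateLoss
  positivity

end TaskMoments

/-! ### The sign symmetry of the task weight -/

section Symmetry

variable {d N M : ℕ} {Λ : Matrix (Fin d) (Fin d) ℝ}

/-- Whether an entry of the parameter lies in one of the blocks `w^V₂₂` and `W^KQ₁₁`. -/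
def isActive : (Idx d × Idx d) ⊕ (Idx d × Idx d) → Bool
  | Sum.inl (Sum.inr _, Sum.inr _) => true
  | Sum.inr (Sum.inl _, Sum.inl _) => true
  | _ => false

/-- The isometry of the parameter space which negates every entry outside `w^V₂₂` and `W^KQ₁₁`. -/
noncomputable def blockFlip (d : ℕ) : Param d ≃ₗᵢ[ℝ] Param d :=
  LinearIsometryEquiv.piLpCongrRight 2 fun i =>
    if isActive i then LinearIsometryEquiv.refl ℝ ℝ else LinearIsometryEquiv.neg ℝ

theorem blockFlip_apply (θ : Param d) (i : (Idx d × Idx d) ⊕ (Idx d × Idx d)) :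
    blockFlip d θ i = if isActive i then θ i else -θ i := by
  simp only [blockFlip, LinearIsometryEquiv.piLpCongrRight_apply]
  split_ifs <;> rfl

theorem offBlockZero_iff (θ : Param d) : OffBlockZero θ ↔ ∀ i, isActive i = false → θ i = 0 := by
  constructor
  · rintro ⟨h1, h2, h3, h4, h5, h6⟩ (⟨i | i, j | j⟩ | ⟨i | i, j | j⟩) h
    · exact congrFun (congrFun h1 i) j
    · exact congrFun h2 i
    · exact congrFun h3 j
    · simp [isActive] at h
    · simp [isActive] at h
    · exact congrFun h4 i
    · exact congrFun h5 j
    · exact h6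
  · intro h
    refine ⟨?_, ?_, ?_, ?_, ?_, ?_⟩
    · ext i j; exact h (Sum.inl (Sum.inl i, Sum.inl j)) rfl
    · ext i; exact h (Sum.inl (Sum.inl i, Sum.inr ())) rfl
    · ext i; exact h (Sum.inl (Sum.inr (), Sum.inl i)) rfl
    · ext i; exact h (Sum.inr (Sum.inl i, Sum.inr ())) rfl
    · ext i; exact h (Sum.inr (Sum.inr (), Sum.inl i)) rfl
    · exact h (Sum.inr (Sum.inr (), Sum.inr ())) rfl

theorem offBlockZero_iff_blockFlip_eq (θ : Param d) : OffBlockZero θ ↔ blockFlip d θ = θ := by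
  rw [offBlockZero_iff]
  constructor
  · intro h
    ext i
    rw [blockFlip_apply]
    split_ifs with hi
    · rfl
    · rw [h i (by simpa using hi), neg_zero]
  · intro h i hi
    have h1 := congrArg (fun θ : Param d => θ i) h
    simp only [blockFlip_apply, hi] at h1
    simp at h1
    linarith

/-- The sign `+1` on the sample rows and `-1` on the label row. -/
def labelSign : Idx d → ℝ := Sum.elim (fun _ => 1) (fun _ => -1)

theorem valRow_blockFlip (θ : Param d) (i : Idx d) :
    valRow (blockFlip d θ) i = -(labelSign i * valRow θ i) := by
  rcases i with i | i <;> simp [valRow, blk21, blk22, WV, blockFlip_apply, isActive, labelSign]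

theorem kqCols_blockFlip (θ : Param d) (i : Idx d) (j : Fin d) :
    kqCols (blockFlip d θ) i j = labelSign i * kqCols θ i j := by
  rcases i with i | i <;>
    simp [kqCols, blk21, blk11, WKQ, blockFlip_apply, isActive, labelSign, Matrix.toBlocks₁₁]

theorem blk11_WKQ_blockFlip (θ : Param d) : blk11 (WKQ (blockFlip d θ)) = blk11 (WKQ θ) := by
  ext i j
  simp [blk11, WKQ, blockFlip_apply, isActive, Matrix.toBlocks₁₁]

theorem sqNorm_blk21_WV_blockFlip (θ : Param d) :
    sqNorm (blk21 (WV (blockFlip d θ))) = sqNorm (blk21 (WV θ)) := by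
  simp [sqNorm, blk21, WV, blockFlip_apply, isActive]

/-- The reflection `w ↦ -w` of the task weight. -/
def negWeight (d N M : ℕ) : Task d N M ≃ᵐ Task d N M :=
  (MeasurableEquiv.neg _).prodCongr (MeasurableEquiv.refl _)

theorem measurePreserving_negWeight :
    MeasurePreserving (negWeight d N M) (taskLaw Λ N M) (taskLaw Λ N M) := by
  refine MeasurePreserving.prod ⟨measurable_neg, ?_⟩ (MeasurePreserving.id _)
  rw [multivariateGaussian_zero_one]
  exact stdGaussian_map (LinearIsometryEquiv.neg ℝ)

theorem withLabels_neg {n : ℕ} (w : Fin d → ℝ) (X : Matrix (Fin d) (Fin n) ℝ) (i : Idx d)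
    (a : Fin n) : withLabels (-w) X i a = labelSign i * withLabels w X i a := by
  rcases i with i | i <;> simp [withLabels, labelSign, Matrix.neg_vecMul]

theorem sfx_negWeight (τ : Task d N M) (i : Idx d) (a : Fin M) :
    Task.sfx (negWeight d N M τ) i a = labelSign i * Task.sfx τ i a :=
  withLabels_neg _ _ i a

theorem Eclean_negWeight (τ : Task d N M) (i : Idx d) (a : (Fin N ⊕ Fin M) ⊕ Unit) :
    Task.Eclean (negWeight d N M τ) i a = labelSign i * Task.Eclean τ i a := by
  rcases a with (a | a) | a
  · exact withLabels_neg _ _ i a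
  · exact withLabels_neg _ _ i a
  · rcases i with i | i
    · exact (one_mul _).symm
    · exact (mul_zero _).symm

theorem yq_negWeight (τ : Task d N M) : Task.yq (negWeight d N M τ) = -Task.yq τ :=
  neg_dotProduct _ _

/-- The loss is invariant under `blockFlip`: negating the off-block entries has the same effect on
the integrands as negating the task weight `w`, whose law is symmetric. -/
theorem surrogateLoss_blockFlip (ε : ℝ) (θ : Param d) :
    surrogateLoss Λ N M ε (blockFlip d θ) = surrogateLoss Λ N M ε θ := by
  have hint : ∀ f : Task d N M → ℝ,
      ∫ τ, f (negWeight d N M τ) ∂(taskLaw Λ N M) = ∫ τ, f τ ∂(taskLaw Λ N M) := fun f =>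
    measurePreserving_negWeight.integral_comp' f
  have hxq : ∀ τ : Task d N M, Task.xq (negWeight d N M τ) = Task.xq τ := fun _ => rfl
  have hs : ∀ i : Idx d, labelSign i ^ 2 = 1 := by
    rintro (i | i) <;> simp [labelSign]
  have h1 : loss1 Λ N M (blockFlip d θ) = loss1 Λ N M θ := by
    unfold loss1
    rw [← hint]
    congr 2
    funext τ
    rw [yq_negWeight, ← neg_sq, neg_sub', neg_neg]
    congr 2
    simp only [dotProduct, mulVec, Matrix.smul_apply, Matrix.mul_apply, Matrix.transpose_apply,
      valRow_blockFlip, kqCols_blockFlip, Eclean_negWeight, hxq, smul_eq_mul]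
    rw [← Finset.sum_neg_distrib]
    refine Finset.sum_congr rfl fun i _ => ?_
    rw [neg_mul, neg_neg]
    simp only [Finset.mul_sum, Finset.sum_mul]
    refine Finset.sum_congr rfl fun j _ => Finset.sum_congr rfl fun k _ =>
      Finset.sum_congr rfl fun a _ => ?_
    ring_nf
    simp only [hs, mul_one, one_mul]
  have h2 : loss2 Λ N M ε (blockFlip d θ) = loss2 Λ N M ε θ := by
    unfold loss2
    rw [blk11_WKQ_blockFlip, sqNorm_blk21_WV_blockFlip]
  have h3 : loss3 Λ N M ε (blockFlip d θ) = loss3 Λ N M ε θ := by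
    unfold loss3
    rw [← hint, blk11_WKQ_blockFlip]
    congr 2
    funext τ
    rw [hxq]
    congr 1
    refine Finset.sum_congr rfl fun a _ => ?_
    rw [← neg_sq]
    congr 1
    simp only [vecMul, dotProduct, valRow_blockFlip, sfx_negWeight]
    rw [← Finset.sum_neg_distrib]
    exact Finset.sum_congr rfl fun i _ => by ring_nf; simp only [hs, one_mul]
  have h4 : loss4 Λ N M ε (blockFlip d θ) = loss4 Λ N M ε θ := by
    unfold loss4
    rw [← hint, sqNorm_blk21_WV_blockFlip]
    congr 2
    funext τ
    rw [hxq]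
    refine Finset.sum_congr rfl fun a _ => ?_
    congr 1
    simp only [mulVec, dotProduct, kqCols_blockFlip, sfx_negWeight, Matrix.transpose_apply,
      Finset.mul_sum]
    exact Finset.sum_congr rfl fun i _ => Finset.sum_congr rfl fun j _ => by
      ring_nf; simp only [hs, one_mul]
  unfold surrogateLoss
  rw [h1, h2, h3, h4]

end Symmetry

/-! ### The loss on parameters with vanishing off-blocks -/

section ReducedLoss

variable {d N M n : ℕ} {Λ : Matrix (Fin d) (Fin d) ℝ}

/-- The unnormalized empirical second moment matrix `∑ₐ xₐ xₐᵀ` of a sample. -/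
def gram (x : Fin n → EuclideanSpace ℝ (Fin d)) : Matrix (Fin d) (Fin d) ℝ :=
  Matrix.of fun i j => ∑ a, x a i * x a j

theorem hasMoments_gram (i j : Fin d) :
    HasMoments (Measure.pi fun _ : Fin n => multivariateGaussian 0 Λ) (fun x => gram x i j) := by
  simp only [gram, Matrix.of_apply]
  exact HasMoments.sum fun a _ => (hasMoments_pi_eval i a).mul (hasMoments_pi_eval j a)

theorem integral_gram (hΛ : Λ.PosSemidef) (i j : Fin d) :
    ∫ x, gram x i j ∂(Measure.pi fun _ : Fin n => multivariateGaussian 0 Λ) = n * Λ i j := by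
  simp only [gram, Matrix.of_apply]
  rw [integral_finsetSum _ fun a _ =>
    ((hasMoments_pi_eval i a).mul (hasMoments_pi_eval j a)).integrable]
  have h : ∀ a : Fin n, ∫ x, x a i * x a j ∂(Measure.pi fun _ : Fin n =>
      multivariateGaussian 0 Λ) = Λ i j := fun a => by
    rw [integral_comp_eval (μ := fun _ : Fin n => multivariateGaussian 0 Λ)
      (f := fun y : EuclideanSpace ℝ (Fin d) => y i * y j)
      ((hasMoments_eval i).mul (hasMoments_eval j)).integrable.aestronglyMeasurable,
      integral_eval_mul_eval hΛ]
  simp [h]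

/-- The second moment of the sample second moment matrix of `n` independent Gaussian vectors: the
diagonal terms contribute fourth moments, the off-diagonal ones factor. -/
theorem integral_gram_mul_gram (hΛ : Λ.PosSemidef) (i j : Fin d) :
    ∫ x, (gram x * gram x) i j ∂(Measure.pi fun _ : Fin n => multivariateGaussian 0 Λ) =
      n * (n + 1) * (Λ * Λ) i j + n * Λ.trace * Λ i j := by
  set μ := Measure.pi fun _ : Fin n => multivariateGaussian 0 Λ with hμ
  have hm : ∀ (a : Fin n) (i : Fin d),
      HasMoments μ (fun x : Fin n → EuclideanSpace ℝ (Fin d) => x a i) :=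
    fun a i => hasMoments_pi_eval i a
  have hexp : ∀ x : Fin n → EuclideanSpace ℝ (Fin d), (gram x * gram x) i j =
      ∑ a, ∑ b, ∑ k, (x a i * x a k) * (x b k * x b j) := fun x => by
    simp only [Matrix.mul_apply, gram, Matrix.of_apply, Finset.sum_mul_sum]
    rw [Finset.sum_comm]
    exact Finset.sum_congr rfl fun a _ => Finset.sum_comm
  have hterm : ∀ a b : Fin n, ∫ x, ∑ k, (x a i * x a k) * (x b k * x b j) ∂μ =
      (Λ * Λ) i j + if a = b then (Λ.trace * Λ i j + (Λ * Λ) i j) else 0 := by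
    intro a b
    by_cases hab : a = b
    · subst hab
      rw [if_pos rfl, hμ]
      have h1 := integral_comp_eval (μ := fun _ : Fin n => multivariateGaussian 0 Λ) (i := a)
        (f := fun y : EuclideanSpace ℝ (Fin d) => ∑ k, (y i * y k) * (y k * y j))
        (HasMoments.sum fun k _ => ((hasMoments_eval i).mul (hasMoments_eval k)).mul
          ((hasMoments_eval k).mul (hasMoments_eval j))).integrable.aestronglyMeasurable
      refine h1.trans ?_
      have h2 := integral_eval_mul_eval_mul_sum_sq hΛ i j
      have h3 : ∀ y : EuclideanSpace ℝ (Fin d), ∑ k, (y i * y k) * (y k * y j) =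
        ∑ k, y i * y j * y k ^ 2 := fun y => Finset.sum_congr rfl fun k _ => by ring
      simp only [h3, h2]
      ring
    · rw [if_neg hab, add_zero, integral_finsetSum _ fun k _ =>
        (((hm a i).mul (hm a k)).mul ((hm b k).mul (hm b j))).integrable, Matrix.mul_apply]
      refine Finset.sum_congr rfl fun k _ => ?_
      have hmeas : ∀ p q : Fin d, Measurable fun y : EuclideanSpace ℝ (Fin d) => y p * y q :=
        fun p q => by fun_prop
      have hind := ((iIndepFun_pi (μ := fun _ : Fin n => multivariateGaussian 0 Λ)
        (X := fun _ : Fin n => (id : EuclideanSpace ℝ (Fin d) → EuclideanSpace ℝ (Fin d)))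
        fun _ => aemeasurable_id).indepFun hab).comp (hmeas i k) (hmeas k j)
      have h1 := hind.integral_fun_mul_eq_mul_integral
        (((hm a i).mul (hm a k)).integrable.aestronglyMeasurable)
        (((hm b k).mul (hm b j)).integrable.aestronglyMeasurable)
      refine h1.trans ?_
      have h2 : ∀ (c : Fin n) (p q : Fin d), ∫ x, x c p * x c q ∂μ = Λ p q := fun c p q => by
        rw [hμ, integral_comp_eval (μ := fun _ : Fin n => multivariateGaussian 0 Λ)
          (f := fun y : EuclideanSpace ℝ (Fin d) => y p * y q)
          ((hasMoments_eval p).mul (hasMoments_eval q)).integrable.aestronglyMeasurable,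
          integral_eval_mul_eval hΛ]
      exact congrArg₂ (· * ·) (h2 a i k) (h2 b k j)
  have hint : ∀ a b : Fin n, Integrable (fun x : Fin n → EuclideanSpace ℝ (Fin d) =>
      ∑ k, (x a i * x a k) * (x b k * x b j)) μ := fun a b =>
    (HasMoments.sum fun k _ => ((hm a i).mul (hm a k)).mul ((hm b k).mul (hm b j))).integrable
  simp only [hexp]
  rw [integral_finsetSum _ fun a _ => integrable_finsetSum _ fun b _ => hint a b]
  simp_rw [integral_finsetSum _ fun b _ => hint _ b, hterm]
  simp [Finset.sum_add_distrib]
  ring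

/-- The law of the context and suffix samples. -/
noncomputable abbrev sampleLaw (Λ : Matrix (Fin d) (Fin d) ℝ) (N M : ℕ) :
    Measure ((Fin N → EuclideanSpace ℝ (Fin d)) × (Fin M → EuclideanSpace ℝ (Fin d))) :=
  (Measure.pi fun _ : Fin N => multivariateGaussian 0 Λ).prod
    (Measure.pi fun _ : Fin M => multivariateGaussian 0 Λ)

/-- The second moment matrix of context and suffix samples together. -/
def totalGram (z : (Fin N → EuclideanSpace ℝ (Fin d)) × (Fin M → EuclideanSpace ℝ (Fin d))) :
    Matrix (Fin d) (Fin d) ℝ := gram z.1 + gram z.2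

theorem hasMoments_gram_fst (i j : Fin d) :
    HasMoments (sampleLaw Λ N M) (fun z => gram z.1 i j) :=
  (hasMoments_gram i j).comp measurePreserving_fst

theorem hasMoments_gram_snd (i j : Fin d) :
    HasMoments (sampleLaw Λ N M) (fun z => gram z.2 i j) :=
  (hasMoments_gram i j).comp measurePreserving_snd

theorem hasMoments_totalGram (i j : Fin d) :
    HasMoments (sampleLaw Λ N M) (fun z => totalGram z i j) :=
  (hasMoments_gram_fst i j).add (hasMoments_gram_snd i j)

theorem integral_totalGram (hΛ : Λ.PosSemidef) (i j : Fin d) :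
    ∫ z, totalGram z i j ∂(sampleLaw Λ N M) = ((N : ℝ) + M) * Λ i j := by
  have h : ∀ z : (Fin N → EuclideanSpace ℝ (Fin d)) × (Fin M → EuclideanSpace ℝ (Fin d)),
    totalGram z i j = gram z.1 i j + gram z.2 i j := fun z => rfl
  simp only [h]
  rw [integral_add (hasMoments_gram_fst i j).integrable (hasMoments_gram_snd i j).integrable,
    integral_fun_fst (μ := Measure.pi fun _ : Fin N => multivariateGaussian 0 Λ)
      (fun x => gram x i j),
    integral_fun_snd (ν := Measure.pi fun _ : Fin M => multivariateGaussian 0 Λ)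
      (fun x => gram x i j), integral_gram hΛ, integral_gram hΛ]
  simp
  ring

theorem integral_totalGram_mul_totalGram (hΛ : Λ.PosSemidef) (hM : 0 < M) (i j : Fin d) :
    ∫ z, (totalGram z * totalGram z) i j ∂(sampleLaw Λ N M) =
      ((N : ℝ) + M) ^ 2 * (Gam Λ N M * Λ) i j := by
  have h : ∀ z : (Fin N → EuclideanSpace ℝ (Fin d)) × (Fin M → EuclideanSpace ℝ (Fin d)),
      (totalGram z * totalGram z) i j = ((gram z.1 * gram z.1) i j + (gram z.2 * gram z.2) i j) +
        ∑ k, (gram z.1 i k * gram z.2 k j + gram z.1 k j * gram z.2 i k) := fun z => by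
    simp only [totalGram, Matrix.add_mul, Matrix.mul_add]
    simp only [Matrix.add_apply, Matrix.mul_apply, Finset.sum_add_distrib]
    rw [show ∑ k, gram z.2 i k * gram z.1 k j = ∑ k, gram z.1 k j * gram z.2 i k from
      Finset.sum_congr rfl fun k _ => mul_comm _ _]
    ring
  have m1 : HasMoments (sampleLaw Λ N M) (fun z => (gram z.1 * gram z.1) i j) :=
    HasMoments.matrix_mul hasMoments_gram_fst hasMoments_gram_fst i j
  have m2 : HasMoments (sampleLaw Λ N M) (fun z => (gram z.2 * gram z.2) i j) :=
    HasMoments.matrix_mul hasMoments_gram_snd hasMoments_gram_snd i j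
  have m3 : ∀ k, HasMoments (sampleLaw Λ N M) (fun z => gram z.1 i k * gram z.2 k j) :=
    fun k => (hasMoments_gram_fst i k).mul (hasMoments_gram_snd k j)
  have m4 : ∀ k, HasMoments (sampleLaw Λ N M) (fun z => gram z.1 k j * gram z.2 i k) :=
    fun k => (hasMoments_gram_fst k j).mul (hasMoments_gram_snd i k)
  simp only [h]
  rw [integral_add (m1.add m2).integrable
      (HasMoments.sum fun k _ => (m3 k).add (m4 k)).integrable,
    integral_add m1.integrable m2.integrable,
    integral_finsetSum _ fun k _ => ((m3 k).add (m4 k)).integrable,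
    integral_fun_fst (μ := Measure.pi fun _ : Fin N => multivariateGaussian 0 Λ)
      (fun x => (gram x * gram x) i j),
    integral_fun_snd (ν := Measure.pi fun _ : Fin M => multivariateGaussian 0 Λ)
      (fun x => (gram x * gram x) i j), integral_gram_mul_gram hΛ, integral_gram_mul_gram hΛ]
  have h5 : ∀ k, ∫ z, (gram z.1 i k * gram z.2 k j + gram z.1 k j * gram z.2 i k)
      ∂(sampleLaw Λ N M) = 2 * ((N : ℝ) * M) * (Λ i k * Λ k j) := fun k => by
    rw [integral_add (m3 k).integrable (m4 k).integrable,
      integral_prod_mul (fun x => gram x i k) (fun x => gram x k j),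
      integral_prod_mul (fun x => gram x k j) (fun x => gram x i k)]
    simp only [integral_gram hΛ]
    ring
  have hn : ((N : ℝ) + M) ≠ 0 := by positivity
  simp only [h5, ← Finset.mul_sum]
  rw [← Matrix.mul_apply, Gam]
  simp only [Matrix.add_mul, Matrix.smul_mul, Matrix.add_apply, Matrix.smul_apply,
    smul_eq_mul, probReal_univ, one_mul]
  field_simp
  ring

/-- Expectation commutes with `F ↦ tr(F K)`. -/
theorem integral_trace_mul {Ω : Type*} [MeasurableSpace Ω] {μ : Measure Ω}
    {F : Ω → Matrix (Fin d) (Fin d) ℝ} {G : Matrix (Fin d) (Fin d) ℝ}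
    (hF : ∀ i j, Integrable (fun x => F x i j) μ) (hG : ∀ i j, ∫ x, F x i j ∂μ = G i j)
    (K : Matrix (Fin d) (Fin d) ℝ) :
    ∫ x, (F x * K).trace ∂μ = (G * K).trace := by
  simp only [Matrix.trace, Matrix.diag, Matrix.mul_apply]
  rw [integral_finsetSum _ fun i _ => integrable_finsetSum _ fun j _ => (hF i j).mul_const _]
  refine Finset.sum_congr rfl fun i _ => ?_
  rw [integral_finsetSum _ fun j _ => (hF i j).mul_const _]
  refine Finset.sum_congr rfl fun j _ => ?_
  rw [integral_mul_const, hG]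

/-- Independence of the weight, the samples and the query. -/
theorem integral_taskLaw_mul (f : EuclideanSpace ℝ (Fin d) → ℝ)
    (g : (Fin N → EuclideanSpace ℝ (Fin d)) × (Fin M → EuclideanSpace ℝ (Fin d)) → ℝ)
    (h : EuclideanSpace ℝ (Fin d) → ℝ) :
    ∫ τ : Task d N M, f τ.1 * (g (τ.2.1, τ.2.2.1) * h τ.2.2.2) ∂(taskLaw Λ N M) =
      (∫ x, f x ∂(multivariateGaussian 0 1)) *
        ((∫ z, g z ∂(sampleLaw Λ N M)) * ∫ x, h x ∂(multivariateGaussian 0 Λ)) := by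
  rw [taskLaw, integral_prod_mul f (fun p : (Fin N → EuclideanSpace ℝ (Fin d)) ×
    (Fin M → EuclideanSpace ℝ (Fin d)) × EuclideanSpace ℝ (Fin d) => g (p.1, p.2.1) * h p.2.2),
    ← integral_prod_mul g h]
  congr 1
  exact ((measurePreserving_prodAssoc (Measure.pi fun _ : Fin N => multivariateGaussian 0 Λ)
    (Measure.pi fun _ : Fin M => multivariateGaussian 0 Λ)
    (multivariateGaussian 0 Λ)).integral_comp' (fun p => g (p.1, p.2.1) * h p.2.2)).symm

/-- For a random matrix `B` depending on the samples only, averaging `(wᵀ B x_q)²` over the weight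
and the query gives `tr(Bᵀ B Λ)`. -/
theorem integral_dotProduct_mulVec_sq (hΛ : Λ.PosSemidef)
    {B : (Fin N → EuclideanSpace ℝ (Fin d)) × (Fin M → EuclideanSpace ℝ (Fin d)) →
      Matrix (Fin d) (Fin d) ℝ}
    (hB : ∀ i j, HasMoments (sampleLaw Λ N M) (fun z => B z i j)) :
    ∫ τ : Task d N M, (Task.w τ ⬝ᵥ (B (τ.2.1, τ.2.2.1) *ᵥ Task.xq τ)) ^ 2 ∂(taskLaw Λ N M) =
      ∫ z, ((B z)ᵀ * B z * Λ).trace ∂(sampleLaw Λ N M) := by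
  have hs : ∀ i j, Λ i j = Λ j i := fun i j => by simpa using hΛ.isHermitian.apply j i
  have hB' : ∀ i j, HasMoments (taskLaw Λ N M)
      (fun τ : Task d N M => B (τ.2.1, τ.2.2.1) i j) := fun i j =>
    (hB i j).comp (φ := fun τ : Task d N M => (τ.2.1, τ.2.2.1)) <|
      (MeasurePreserving.id _).prod measurePreserving_fst |>.comp measurePreserving_snd
  have hexp : ∀ τ : Task d N M, (Task.w τ ⬝ᵥ (B (τ.2.1, τ.2.2.1) *ᵥ Task.xq τ)) ^ 2 =
      ∑ i, ∑ j, ∑ k, ∑ l, (Task.w τ i * Task.w τ j) *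
        ((B (τ.2.1, τ.2.2.1) i k * B (τ.2.1, τ.2.2.1) j l) * (Task.xq τ k * Task.xq τ l)) := by
    intro τ
    have h : Task.w τ ⬝ᵥ (B (τ.2.1, τ.2.2.1) *ᵥ Task.xq τ) =
        ∑ i, ∑ k, Task.w τ i * (B (τ.2.1, τ.2.2.1) i k * Task.xq τ k) := by
      simp only [dotProduct, mulVec, Finset.mul_sum]
    rw [h, pow_two, Finset.sum_mul_sum]
    simp only [Finset.sum_mul_sum]
    refine Finset.sum_congr rfl fun i _ => Finset.sum_congr rfl fun j _ => ?_
    refine Finset.sum_congr rfl fun k _ => Finset.sum_congr rfl fun l _ => ?_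
    ring
  have hm : ∀ i j k l, HasMoments (taskLaw Λ N M) fun τ : Task d N M =>
      (Task.w τ i * Task.w τ j) *
        ((B (τ.2.1, τ.2.2.1) i k * B (τ.2.1, τ.2.2.1) j l) * (Task.xq τ k * Task.xq τ l)) :=
    fun i j k l => ((hasMoments_w i).mul (hasMoments_w j)).mul
      (((hB' i k).mul (hB' j l)).mul ((hasMoments_xq k).mul (hasMoments_xq l)))
  have hval : ∀ i j k l, ∫ τ : Task d N M, (Task.w τ i * Task.w τ j) *
        ((B (τ.2.1, τ.2.2.1) i k * B (τ.2.1, τ.2.2.1) j l) * (Task.xq τ k * Task.xq τ l))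
          ∂(taskLaw Λ N M) =
      (1 : Matrix (Fin d) (Fin d) ℝ) i j *
        ((∫ z, B z i k * B z j l ∂(sampleLaw Λ N M)) * Λ k l) := fun i j k l => by
    rw [← integral_eval_mul_eval Matrix.PosSemidef.one i j, ← integral_eval_mul_eval hΛ k l]
    exact integral_taskLaw_mul (fun x => x i * x j) (fun z => B z i k * B z j l)
      (fun x => x k * x l)
  simp only [hexp]
  rw [integral_finsetSum _ fun i _ => (HasMoments.sum fun j _ => HasMoments.sum fun k _ =>
    HasMoments.sum fun l _ => hm i j k l).integrable]
  simp_rw [integral_finsetSum _ fun j _ => (HasMoments.sum fun k _ =>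
    HasMoments.sum fun l _ => hm _ j k l).integrable]
  simp_rw [integral_finsetSum _ fun k _ => (HasMoments.sum fun l _ => hm _ _ k l).integrable]
  simp_rw [integral_finsetSum _ fun l _ => (hm _ _ _ l).integrable, hval]
  have hrhs : ∀ z, ((B z)ᵀ * B z * Λ).trace = ∑ i, ∑ k, ∑ l, B z i k * B z i l * Λ k l := by
    intro z
    simp only [Matrix.trace, Matrix.diag, Matrix.mul_apply, Matrix.transpose_apply,
      Finset.sum_mul]
    calc _ = ∑ k, ∑ i, ∑ l, B z i k * B z i l * Λ l k :=
          Finset.sum_congr rfl fun k _ => Finset.sum_comm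
      _ = ∑ i, ∑ k, ∑ l, B z i k * B z i l * Λ l k := Finset.sum_comm
      _ = _ := Finset.sum_congr rfl fun i _ => Finset.sum_congr rfl fun k _ =>
          Finset.sum_congr rfl fun l _ => by rw [hs]
  simp only [hrhs]
  have hn : ∀ i k l, HasMoments (sampleLaw Λ N M) fun z => B z i k * B z i l * Λ k l :=
    fun i k l => ((hB i k).mul (hB i l)).mul (hasMoments_const _)
  rw [integral_finsetSum _ fun i _ => (HasMoments.sum fun k _ =>
    HasMoments.sum fun l _ => hn i k l).integrable]
  simp_rw [integral_finsetSum _ fun k _ => (HasMoments.sum fun l _ => hn _ k l).integrable]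
  simp_rw [integral_finsetSum _ fun l _ => (hn _ _ l).integrable, integral_mul_const]
  refine Finset.sum_congr rfl fun i _ => ?_
  rw [Finset.sum_eq_single i]
  · simp
  · intro j _ hj
    simp [Matrix.one_apply_ne hj.symm]
  · simp

/-- The surrogate loss on parameters with vanishing off-blocks, as a function of the product
`P = w^V₂₂ W^KQ₁₁`. -/
noncomputable def reducedLoss (Λ : Matrix (Fin d) (Fin d) ℝ) (N M : ℕ) (ε : ℝ)
    (P : Matrix (Fin d) (Fin d) ℝ) : ℝ :=
  2 * ((Pᵀ * regMat Λ N M ε * P * Λ).trace - 2 * (Λ * P * Λ).trace + Λ.trace)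

/-- The clean loss: averaging over `w` and `x_q` leaves the trace of a quadratic polynomial in the
sample second moment matrix, whose first two moments are known. -/
theorem loss1_of_offBlockZero (hΛ : Λ.PosSemidef) (hM : 0 < M) {θ : Param d}
    (hθ : OffBlockZero θ) {P : Matrix (Fin d) (Fin d) ℝ}
    (hP : P = blk22 (WV θ) • blk11 (WKQ θ)) :
    loss1 Λ N M θ =
      2 * ((Pᵀ * (Gam Λ N M * Λ) * P * Λ).trace - 2 * (Λ * P * Λ).trace + Λ.trace) := by
  have hn : ((N : ℝ) + M) ≠ 0 := by positivity
  set c : ℝ := 1 / ((N : ℝ) + M) with hc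
  have hs : Λᵀ = Λ := (show Λ.IsSymm by simpa using hΛ.isHermitian).eq
  obtain ⟨-, -, h21, -, hk21, -⟩ := hθ
  -- `v_θ` and `U_θ` are supported on `w^V₂₂` and `W^KQ₁₁`, so the prediction error is bilinear in
  -- `w` and `x_q`
  have hpt : ∀ τ : Task d N M,
      valRow θ ⬝ᵥ ((c • (Task.Eclean τ * (Task.Eclean τ)ᵀ)) *ᵥ (kqCols θ *ᵥ Task.xq τ))
        - Task.yq τ =
      Task.w τ ⬝ᵥ ((totalGram (τ.2.1, τ.2.2.1) * (c • P) - 1) *ᵥ Task.xq τ) := by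
    intro τ
    -- the query column carries the label zero, so it drops out of the label row of `E Eᵀ`
    have hE : ∀ j, (Task.Eclean τ * (Task.Eclean τ)ᵀ) (Sum.inr ()) (Sum.inl j) =
        (Task.w τ ᵥ* totalGram (τ.2.1, τ.2.2.1)) j := by
      intro j
      rw [Matrix.mul_apply, Fintype.sum_sum_type, Fintype.sum_sum_type]
      simp only [Task.Eclean, Task.sfx, withLabels, Matrix.transpose_apply,
        Matrix.fromCols_apply_inl, Matrix.fromCols_apply_inr, Matrix.fromRows_apply_inl,
        Matrix.fromRows_apply_inr, Matrix.replicateRow_apply, Matrix.zero_apply, zero_mul,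
        Finset.sum_const_zero, add_zero, vecMul, dotProduct, totalGram, Matrix.add_apply, gram,
        Matrix.of_apply, mul_add, Finset.sum_add_distrib, Finset.sum_mul, Finset.mul_sum]
      congr 1
      · rw [Finset.sum_comm]
        exact Finset.sum_congr rfl fun _ _ => Finset.sum_congr rfl fun _ _ => mul_assoc _ _ _
      · rw [Finset.sum_comm]
        exact Finset.sum_congr rfl fun _ _ => Finset.sum_congr rfl fun _ _ => mul_assoc _ _ _
    have hK : kqCols θ *ᵥ Task.xq τ =
        Sum.elim (blk11 (WKQ θ) *ᵥ Task.xq τ) (fun _ => 0) := by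
      rw [kqCols, hk21, Matrix.fromRows_mulVec]
      congr 1
      funext i
      simp [mulVec, dotProduct]
    have hv : valRow θ = Sum.elim (0 : Fin d → ℝ) (fun _ => blk22 (WV θ)) := by rw [valRow, h21]
    rw [hK, hv, hP, Matrix.sub_mulVec, dotProduct_sub, Matrix.one_mulVec, Task.yq]
    congr 1
    rw [Matrix.smul_mulVec, dotProduct_smul, smul_smul, Matrix.mul_smul, Matrix.smul_mulVec,
      dotProduct_smul, ← Matrix.mulVec_mulVec (Task.xq τ), Matrix.dotProduct_mulVec (Task.w τ),
      smul_eq_mul, smul_eq_mul, mul_assoc]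
    congr 1
    simp only [dotProduct, mulVec, Fintype.sum_sum_type, Sum.elim_inl, Sum.elim_inr, hE,
      Pi.zero_apply, zero_mul, Finset.sum_const_zero, zero_add, mul_zero, add_zero,
      Finset.univ_unique, Finset.sum_singleton]
  set Q := c • P with hQ
  have hB : ∀ i j, HasMoments (sampleLaw Λ N M) (fun z => (totalGram z * Q - 1) i j) :=
    fun i j => (HasMoments.matrix_mul hasMoments_totalGram
      (fun i j => hasMoments_const (Q i j)) i j).sub (hasMoments_const _)
  have htr : ∀ z : (Fin N → EuclideanSpace ℝ (Fin d)) × (Fin M → EuclideanSpace ℝ (Fin d)),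
      ((totalGram z * Q - 1)ᵀ * (totalGram z * Q - 1) * Λ).trace =
        (totalGram z * totalGram z * (Q * Λ * Qᵀ)).trace - 2 * (totalGram z * (Q * Λ)).trace
          + Λ.trace := by
    intro z
    have hG : (totalGram z)ᵀ = totalGram z := by
      ext i j
      simp [totalGram, gram, mul_comm]
    have e1 : (totalGram z * totalGram z * (Q * Λ * Qᵀ)).trace =
        (Qᵀ * totalGram z * (totalGram z * Q) * Λ).trace := by
      rw [← Matrix.mul_assoc, Matrix.trace_mul_comm]
      simp only [Matrix.mul_assoc]
    have e2 : (Qᵀ * totalGram z * Λ).trace = (totalGram z * (Q * Λ)).trace := by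
      rw [← Matrix.trace_transpose]
      simp only [Matrix.transpose_mul, Matrix.transpose_transpose, hG, hs]
      rw [Matrix.trace_mul_comm, Matrix.mul_assoc]
    simp only [Matrix.transpose_sub, Matrix.transpose_mul, hG, Matrix.transpose_one,
      Matrix.sub_mul, Matrix.mul_sub, Matrix.mul_one, Matrix.one_mul, Matrix.trace_sub, e1, e2]
    rw [Matrix.mul_assoc (totalGram z) Q Λ]
    ring
  have m2 : ∀ i j, HasMoments (sampleLaw Λ N M) (fun z => (totalGram z * totalGram z) i j) :=
    HasMoments.matrix_mul hasMoments_totalGram hasMoments_totalGram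
  have hI : ∀ (F : (Fin N → EuclideanSpace ℝ (Fin d)) × (Fin M → EuclideanSpace ℝ (Fin d)) →
      Matrix (Fin d) (Fin d) ℝ) (K : Matrix (Fin d) (Fin d) ℝ),
      (∀ i j, HasMoments (sampleLaw Λ N M) (fun z => F z i j)) →
      Integrable (fun z => (F z * K).trace) (sampleLaw Λ N M) := fun F K hF => by
    simp only [Matrix.trace, Matrix.diag, Matrix.mul_apply]
    exact (HasMoments.sum fun i _ => HasMoments.sum fun j _ =>
      (hF i j).mul (hasMoments_const (K j i))).integrable
  have i1 := hI _ (Q * Λ * Qᵀ) m2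
  have i2 := (hI _ (Q * Λ) hasMoments_totalGram).const_mul 2
  have i3 : Integrable (fun z => (totalGram z * totalGram z * (Q * Λ * Qᵀ)).trace -
      2 * (totalGram z * (Q * Λ)).trace) (sampleLaw Λ N M) := i1.sub i2
  unfold loss1
  simp only [← hc, hpt]
  rw [integral_dotProduct_mulVec_sq hΛ hB]
  simp only [htr]
  rw [integral_add i3 (integrable_const _), integral_sub i1 i2, integral_const_mul,
    integral_trace_mul (G := (((N : ℝ) + M) ^ 2) • (Gam Λ N M * Λ)) (fun i j => (m2 i j).integrable)
      (fun i j => integral_totalGram_mul_totalGram hΛ hM i j),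
    integral_trace_mul (G := ((N : ℝ) + M) • Λ) (fun i j => (hasMoments_totalGram i j).integrable)
      (fun i j => integral_totalGram hΛ i j), integral_const]
  have e3 : (Gam Λ N M * Λ * (P * Λ * Pᵀ)).trace = (Pᵀ * (Gam Λ N M * Λ) * P * Λ).trace := by
    rw [← Matrix.mul_assoc, Matrix.trace_mul_comm]
    simp only [Matrix.mul_assoc]
  simp only [hQ, Matrix.transpose_smul, Matrix.smul_mul, Matrix.mul_smul, Matrix.trace_smul,
    smul_eq_mul, e3, probReal_univ, one_mul]
  rw [Matrix.mul_assoc Λ P Λ, hc]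
  field_simp

theorem integral_sqNorm_mulVec (hΛ : Λ.PosSemidef) (W : Matrix (Fin d) (Fin d) ℝ) :
    ∫ x : EuclideanSpace ℝ (Fin d), sqNorm (W *ᵥ fun i => x i) ∂(multivariateGaussian 0 Λ) =
      (W * Λ * Wᵀ).trace := by
  have hexp : ∀ x : EuclideanSpace ℝ (Fin d), sqNorm (W *ᵥ fun i => x i) =
      ∑ i, ∑ k, ∑ l, (W i k * W i l) * (x k * x l) := fun x => by
    simp only [sqNorm, mulVec, dotProduct, pow_two, Finset.sum_mul_sum]
    exact Finset.sum_congr rfl fun i _ => Finset.sum_congr rfl fun k _ =>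
      Finset.sum_congr rfl fun l _ => by ring
  have hm : ∀ i k l, HasMoments (multivariateGaussian 0 Λ)
      fun x : EuclideanSpace ℝ (Fin d) => (W i k * W i l) * (x k * x l) := fun i k l =>
    ((hasMoments_eval k).mul (hasMoments_eval l)).const_mul _
  simp only [hexp]
  rw [integral_finsetSum _ fun i _ => (HasMoments.sum fun k _ =>
    HasMoments.sum fun l _ => hm i k l).integrable]
  simp_rw [integral_finsetSum _ fun k _ => (HasMoments.sum fun l _ => hm _ k l).integrable]
  simp_rw [integral_finsetSum _ fun l _ => (hm _ _ l).integrable, integral_const_mul,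
    integral_eval_mul_eval hΛ]
  simp only [Matrix.trace, Matrix.diag, Matrix.mul_apply, Matrix.transpose_apply, Finset.sum_mul]
  refine Finset.sum_congr rfl fun i _ => ?_
  rw [Finset.sum_comm]
  exact Finset.sum_congr rfl fun k _ => Finset.sum_congr rfl fun l _ => by ring

/-- The only perturbation term that survives: its integrand is a product of functions of the
independent vectors `w`, `X^sfx` and `x_q`. -/
theorem loss3_of_offBlockZero (hΛ : Λ.PosSemidef) (ε : ℝ) {θ : Param d}
    (hθ : OffBlockZero θ) {P : Matrix (Fin d) (Fin d) ℝ}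
    (hP : P = blk22 (WV θ) • blk11 (WKQ θ)) :
    loss3 Λ N M ε θ = 2 * (ε ^ 2 * psi Λ N M * (Pᵀ * P * Λ).trace) := by
  obtain ⟨-, -, h21, -, -, -⟩ := hθ
  set v := blk22 (WV θ) with hv
  set W := blk11 (WKQ θ) with hW
  have hpt : ∀ τ : Task d N M, sqNorm (W *ᵥ Task.xq τ) * sqNorm (valRow θ ᵥ* Task.sfx τ) =
      ∑ i, ∑ j, v ^ 2 * ((τ.1 i * τ.1 j) *
        (gram τ.2.2.1 i j * sqNorm (W *ᵥ fun i => τ.2.2.2 i))) := by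
    intro τ
    have h1 : ∀ m, (valRow θ ᵥ* Task.sfx τ) m = v * ∑ i, τ.1 i * τ.2.2.1 m i := by
      intro m
      rw [vecMul, dotProduct, Fintype.sum_sum_type]
      simp only [valRow, h21, Sum.elim_inl, Sum.elim_inr, Pi.zero_apply, zero_mul,
        Finset.sum_const_zero, zero_add, Finset.univ_unique, Finset.sum_singleton, ← hv]
      rfl
    have h2 : sqNorm (valRow θ ᵥ* Task.sfx τ) =
        ∑ i, ∑ j, v ^ 2 * ((τ.1 i * τ.1 j) * gram τ.2.2.1 i j) := by
      simp only [sqNorm, h1, gram, Matrix.of_apply, mul_pow, ← Finset.mul_sum]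
      congr 1
      simp only [pow_two, Finset.sum_mul_sum]
      rw [Finset.sum_comm]
      refine Finset.sum_congr rfl fun i _ => ?_
      rw [Finset.sum_comm]
      refine Finset.sum_congr rfl fun j _ => ?_
      rw [Finset.mul_sum]
      exact Finset.sum_congr rfl fun m _ => by ring
    rw [h2, mul_comm, Finset.sum_mul]
    refine Finset.sum_congr rfl fun i _ => ?_
    rw [Finset.sum_mul]
    refine Finset.sum_congr rfl fun j _ => ?_
    change _ * sqNorm (W *ᵥ fun i => τ.2.2.2 i) = _
    ring
  have hm : ∀ i j, HasMoments (taskLaw Λ N M) fun τ : Task d N M => v ^ 2 * ((τ.1 i * τ.1 j) *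
        (gram τ.2.2.1 i j * sqNorm (W *ᵥ fun i => τ.2.2.2 i))) := fun i j => by
    refine HasMoments.const_mul (((hasMoments_w i).mul (hasMoments_w j)).mul (HasMoments.mul ?_ ?_))
      _
    · simp only [gram, Matrix.of_apply]
      exact HasMoments.sum fun m _ => (hasMoments_Xsfx i m).mul (hasMoments_Xsfx j m)
    · simp only [sqNorm, pow_two]
      have h : ∀ k, HasMoments (taskLaw Λ N M)
          fun τ : Task d N M => (W *ᵥ fun i => τ.2.2.2 i) k := fun k =>
        HasMoments.dotProduct (fun l => hasMoments_const (W k l)) hasMoments_xq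
      exact HasMoments.sum fun k _ => (h k).mul (h k)
  have hval : ∀ i j, ∫ τ : Task d N M, v ^ 2 * ((τ.1 i * τ.1 j) *
      (gram τ.2.2.1 i j * sqNorm (W *ᵥ fun i => τ.2.2.2 i))) ∂(taskLaw Λ N M) =
      v ^ 2 * ((1 : Matrix (Fin d) (Fin d) ℝ) i j * (M * Λ i j * (W * Λ * Wᵀ).trace)) :=
      fun i j => by
    rw [integral_const_mul, integral_taskLaw_mul (fun x => x i * x j) (fun z => gram z.2 i j)
      (fun x => sqNorm (W *ᵥ fun i => x i)), integral_eval_mul_eval Matrix.PosSemidef.one,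
      integral_sqNorm_mulVec hΛ, integral_fun_snd
        (ν := Measure.pi fun _ : Fin M => multivariateGaussian 0 Λ) (fun x => gram x i j),
      integral_gram hΛ]
    simp
  unfold loss3
  simp only [← hW, hpt]
  rw [integral_finsetSum _ fun i _ => (HasMoments.sum fun j _ => hm i j).integrable]
  simp_rw [integral_finsetSum _ fun j _ => (hm _ j).integrable, hval]
  have hsum : ∑ i, ∑ j, v ^ 2 * ((1 : Matrix (Fin d) (Fin d) ℝ) i j *
      (M * Λ i j * (W * Λ * Wᵀ).trace)) = v ^ 2 * (M * Λ.trace * (W * Λ * Wᵀ).trace) := by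
    simp only [Matrix.one_apply, ite_mul, one_mul, zero_mul, mul_ite, mul_zero,
      Finset.sum_ite_eq, Finset.mem_univ, if_true, Matrix.trace, Matrix.diag, ← Finset.mul_sum,
      ← Finset.sum_mul]
  have htr : (Pᵀ * P * Λ).trace = v ^ 2 * (W * Λ * Wᵀ).trace := by
    rw [hP, Matrix.trace_mul_comm (W * Λ), ← Matrix.mul_assoc]
    simp only [Matrix.transpose_smul, Matrix.smul_mul, Matrix.mul_smul, Matrix.trace_smul,
      smul_eq_mul]
    ring
  rw [hsum, htr, psi]
  ring

/-- With vanishing off-blocks only `ℓ₁` and `ℓ₃` survive, and they depend on the parameters through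
the product `w^V₂₂ W^KQ₁₁` alone. -/
theorem surrogateLoss_of_offBlockZero (hΛ : Λ.PosSemidef) (hM : 0 < M) (ε : ℝ) {θ : Param d}
    (hθ : OffBlockZero θ) :
    surrogateLoss Λ N M ε θ = reducedLoss Λ N M ε (blk22 (WV θ) • blk11 (WKQ θ)) := by
  have h21 : sqNorm (blk21 (WV θ)) = 0 := by simp [hθ.2.2.1, sqNorm]
  unfold surrogateLoss
  rw [loss1_of_offBlockZero hΛ hM hθ rfl, loss3_of_offBlockZero hΛ ε hθ rfl, loss2, loss4, h21]
  simp only [reducedLoss, regMat, Matrix.mul_add, Matrix.add_mul, Matrix.trace_add,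
    Matrix.mul_smul, Matrix.smul_mul, Matrix.mul_one, Matrix.trace_smul, smul_eq_mul]
  ring

end ReducedLoss

/-! ### Frobenius norm and trace forms -/

section FrobeniusNorm

variable {d : ℕ}

open scoped Matrix.Norms.Frobenius in
theorem frobNorm_nonneg (A : Matrix (Fin d) (Fin d) ℝ) : 0 ≤ frobNorm A := norm_nonneg A

theorem frobNorm_mul_le (A B : Matrix (Fin d) (Fin d) ℝ) :
    frobNorm (A * B) ≤ frobNorm A * frobNorm B := Matrix.frobenius_norm_mul A B

theorem frobNorm_transpose (A : Matrix (Fin d) (Fin d) ℝ) : frobNorm Aᵀ = frobNorm A :=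
  Matrix.frobenius_norm_transpose A

theorem frobNorm_sq (A : Matrix (Fin d) (Fin d) ℝ) : frobNorm A ^ 2 = ∑ i, ∑ j, A i j ^ 2 := by
  have h : frobNorm A = (∑ i, ∑ j, ‖A i j‖ ^ (2 : ℝ)) ^ (1 / 2 : ℝ) := Matrix.frobenius_norm_def A
  rw [h, ← Real.sqrt_eq_rpow, Real.sq_sqrt]
  · simp
  · positivity

theorem trace_transpose_mul_self (A : Matrix (Fin d) (Fin d) ℝ) :
    (Aᵀ * A).trace = frobNorm A ^ 2 := by
  rw [frobNorm_sq, Finset.sum_comm]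
  simp [Matrix.trace, Matrix.mul_apply, pow_two]

theorem frobNorm_eq_zero {A : Matrix (Fin d) (Fin d) ℝ} : frobNorm A = 0 ↔ A = 0 := by
  rw [← sq_eq_zero_iff, ← trace_transpose_mul_self, ← Matrix.conjTranspose_eq_transpose_of_trivial,
    Matrix.trace_conjTranspose_mul_self_eq_zero_iff]

/-- The Cauchy–Schwarz inequality for the Frobenius inner product. -/
theorem abs_trace_transpose_mul_le (A B : Matrix (Fin d) (Fin d) ℝ) :
    |(Aᵀ * B).trace| ≤ frobNorm A * frobNorm B := by
  have h1 : (Aᵀ * B).trace = ∑ p : Fin d × Fin d, A p.1 p.2 * B p.1 p.2 := by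
    rw [Fintype.sum_prod_type, Finset.sum_comm]
    simp [Matrix.trace, Matrix.mul_apply]
  have h2 : ∀ C : Matrix (Fin d) (Fin d) ℝ,
      frobNorm C ^ 2 = ∑ p : Fin d × Fin d, C p.1 p.2 ^ 2 := fun C => by
    rw [frobNorm_sq, Fintype.sum_prod_type]
  refine abs_le_of_sq_le_sq ?_ (mul_nonneg (frobNorm_nonneg A) (frobNorm_nonneg B))
  rw [h1, mul_pow, h2, h2]
  exact Finset.sum_mul_sq_le_sq_mul_sq _ _ _

/-- A positive definite real matrix has an invertible symmetric square root. -/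
theorem exists_sqrt_of_posDef {A : Matrix (Fin d) (Fin d) ℝ} (hA : A.PosDef) :
    ∃ R : Matrix (Fin d) (Fin d) ℝ, Rᵀ = R ∧ R * R = A ∧ IsUnit R := by
  open scoped MatrixOrder in
  refine ⟨CFC.sqrt A, ?_, CFC.sqrt_mul_sqrt_self A hA.posSemidef.nonneg, ?_⟩
  · rw [← Matrix.conjTranspose_eq_transpose_of_trivial]
    exact (CFC.sqrt_nonneg A).posSemidef.isHermitian
  · have h := CFC.sqrt_mul_sqrt_self A hA.posSemidef.nonneg
    exact isUnit_of_mul_isUnit_left (h.symm ▸ hA.isUnit)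

/-- For positive definite `A` and `Λ`, the quadratic form `D ↦ tr(Dᵀ A D Λ)` dominates the squared
Frobenius norm. -/
theorem exists_mul_frobNorm_sq_le_trace {A Λ : Matrix (Fin d) (Fin d) ℝ} (hA : A.PosDef)
    (hΛ : Λ.PosDef) :
    ∃ c : ℝ, 0 < c ∧ ∀ D : Matrix (Fin d) (Fin d) ℝ,
      c * frobNorm D ^ 2 ≤ (Dᵀ * A * D * Λ).trace := by
  obtain ⟨S, hS, hSA, hSu⟩ := exists_sqrt_of_posDef hA
  obtain ⟨R, hR, hRΛ, hRu⟩ := exists_sqrt_of_posDef hΛ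
  have hSdet := (Matrix.isUnit_iff_isUnit_det S).1 hSu
  have hRdet := (Matrix.isUnit_iff_isUnit_det R).1 hRu
  set K : ℝ := frobNorm S⁻¹ * frobNorm R⁻¹ with hK
  have hK0 : 0 ≤ K := mul_nonneg (frobNorm_nonneg _) (frobNorm_nonneg _)
  refine ⟨1 / (K ^ 2 + 1), by positivity, fun D => ?_⟩
  have htr : (Dᵀ * A * D * Λ).trace = frobNorm (S * D * R) ^ 2 := by
    rw [← trace_transpose_mul_self, ← hSA, ← hRΛ]
    simp only [Matrix.transpose_mul, hS, hR]
    rw [Matrix.mul_assoc R, Matrix.trace_mul_comm R]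
    simp only [Matrix.mul_assoc]
  have hD : D = S⁻¹ * (S * D * R) * R⁻¹ := by
    rw [Matrix.mul_assoc S, ← Matrix.mul_assoc S⁻¹, Matrix.nonsing_inv_mul _ hSdet, Matrix.one_mul,
      Matrix.mul_assoc, Matrix.mul_nonsing_inv _ hRdet, Matrix.mul_one]
  have hle : frobNorm D ≤ K * frobNorm (S * D * R) := by
    calc frobNorm D = frobNorm (S⁻¹ * (S * D * R) * R⁻¹) := by rw [← hD]
      _ ≤ frobNorm S⁻¹ * frobNorm (S * D * R) * frobNorm R⁻¹ :=
          (frobNorm_mul_le _ _).trans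
            (mul_le_mul_of_nonneg_right (frobNorm_mul_le _ _) (frobNorm_nonneg _))
      _ = K * frobNorm (S * D * R) := by rw [hK]; ring
  have hsq : frobNorm D ^ 2 ≤ K ^ 2 * frobNorm (S * D * R) ^ 2 := by
    rw [← mul_pow]
    exact pow_le_pow_left₀ (frobNorm_nonneg _) hle 2
  rw [htr, div_mul_eq_mul_div, one_mul, div_le_iff₀ (by positivity)]
  nlinarith [sq_nonneg (frobNorm (S * D * R))]

/-- The quadratic form of a real matrix is bounded by its operator norm. -/
theorem dotProduct_mulVec_le_opNorm (B : Matrix (Fin d) (Fin d) ℝ) (y : Fin d → ℝ) :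
    y ⬝ᵥ B *ᵥ y ≤ opNorm B * (y ⬝ᵥ y) := by
  have h1 : ‖(WithLp.toLp 2 (B *ᵥ y) : EuclideanSpace ℝ (Fin d))‖ ≤
      opNorm B * ‖(WithLp.toLp 2 y : EuclideanSpace ℝ (Fin d))‖ :=
    Matrix.l2_opNorm_mulVec B (WithLp.toLp 2 y)
  have h2 := real_inner_le_norm (WithLp.toLp 2 (B *ᵥ y) : EuclideanSpace ℝ (Fin d))
    (WithLp.toLp 2 y)
  rw [EuclideanSpace.inner_toLp_toLp, star_trivial] at h2
  have h3 : ‖(WithLp.toLp 2 y : EuclideanSpace ℝ (Fin d))‖ ^ 2 = y ⬝ᵥ y := by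
    rw [← real_inner_self_eq_norm_sq, EuclideanSpace.inner_toLp_toLp, star_trivial]
  rw [← h3]
  nlinarith [norm_nonneg (WithLp.toLp 2 y : EuclideanSpace ℝ (Fin d))]

open scoped Matrix.Norms.L2Operator in
theorem opNorm_nonneg (B : Matrix (Fin d) (Fin d) ℝ) : 0 ≤ opNorm B := norm_nonneg B

end FrobeniusNorm

/-! ### The minimizer of the reduced loss and the initialization -/

section RegMat

variable {d N M : ℕ} {Λ : Matrix (Fin d) (Fin d) ℝ} {ε : ℝ}

theorem regMat_eq : regMat Λ N M ε = (((N : ℝ) + M + 1) / ((N : ℝ) + M)) • (Λ * Λ) +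
    ((Λ.trace / ((N : ℝ) + M)) • Λ + (ε ^ 2 * psi Λ N M) • (1 : Matrix (Fin d) (Fin d) ℝ)) := by
  rw [regMat, Gam, Matrix.add_mul, Matrix.smul_mul, Matrix.smul_mul, Matrix.one_mul, add_assoc]

theorem posDef_regMat (hΛ : Λ.PosDef) (hM : 0 < M) (ε : ℝ) : (regMat Λ N M ε).PosDef := by
  have hn : (0 : ℝ) < (N : ℝ) + M := by positivity
  have htr := hΛ.posSemidef.trace_nonneg
  have hs : Λᴴ = Λ := hΛ.isHermitian
  have hinj : Function.Injective Λ.mulVec := Matrix.mulVec_injective_of_isUnit hΛ.isUnit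
  have h1 : (Λ * Λ).PosDef := by
    have := Matrix.PosDef.conjTranspose_mul_self Λ hinj
    rwa [hs] at this
  rw [regMat_eq]
  refine (h1.smul (by positivity)).add_posSemidef
    ((hΛ.posSemidef.smul (by positivity)).add (Matrix.PosSemidef.one.smul ?_))
  unfold psi
  positivity

theorem commute_regMat {R : Matrix (Fin d) (Fin d) ℝ} (hR : Commute R Λ) :
    Commute R (regMat Λ N M ε) := by
  rw [regMat_eq]
  exact ((hR.mul_right hR).smul_right _).add_right
    ((hR.smul_right _).add_right ((Commute.one_right R).smul_right _))

/-- `tr(Pᵀ A P Λ) ≤ ‖A Λ⁻¹‖ tr(Pᵀ Λ P Λ)`, where `A` is the regularized matrix,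
because `A ≤ ‖A Λ⁻¹‖ Λ` in the Loewner order. -/
theorem trace_regMat_le (hΛ : Λ.PosDef) (hM : 0 < M) (P : Matrix (Fin d) (Fin d) ℝ) :
    (Pᵀ * regMat Λ N M ε * P * Λ).trace ≤
      opNorm (regMat Λ N M ε * Λ⁻¹) * (Pᵀ * Λ * P * Λ).trace := by
  obtain ⟨R, hR, hRΛ, hRu⟩ := exists_sqrt_of_posDef hΛ
  have hRdet := (Matrix.isUnit_iff_isUnit_det R).1 hRu
  set A := regMat Λ N M ε with hA
  set b := opNorm (A * Λ⁻¹) with hb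
  -- the square root of `Λ` commutes with the polynomial `A` in `Λ`, so `A = R (A Λ⁻¹) R`
  have hcomm : R * A = A * R := commute_regMat (hRΛ ▸ (Commute.refl R).mul_right (Commute.refl R))
  have hARR : A = R * (A * Λ⁻¹) * R := by
    rw [← Matrix.mul_assoc R A, hcomm, ← hRΛ, Matrix.mul_inv_rev]
    simp only [Matrix.mul_assoc]
    rw [Matrix.nonsing_inv_mul _ hRdet, Matrix.mul_one, Matrix.mul_nonsing_inv _ hRdet,
      Matrix.mul_one]
  have hpsd : (b • Λ - A).PosSemidef := by
    refine Matrix.PosSemidef.of_dotProduct_mulVec_nonneg ?_ fun x => ?_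
    · exact (hΛ.posSemidef.smul (opNorm_nonneg _)).isHermitian.sub
        (posDef_regMat hΛ hM ε).isHermitian
    · have h1 := dotProduct_mulVec_le_opNorm (A * Λ⁻¹) (R *ᵥ x)
      have h2 : (R *ᵥ x) ⬝ᵥ (A * Λ⁻¹) *ᵥ (R *ᵥ x) = x ⬝ᵥ A *ᵥ x := by
        rw [Matrix.mulVec_mulVec, dotProduct_comm, Matrix.dotProduct_mulVec,
          ← Matrix.mulVec_transpose, hR, Matrix.mulVec_mulVec, ← Matrix.mul_assoc, ← hARR,
          dotProduct_comm]
      have h3 : (R *ᵥ x) ⬝ᵥ (R *ᵥ x) = x ⬝ᵥ Λ *ᵥ x := by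
        rw [Matrix.dotProduct_mulVec, ← Matrix.mulVec_transpose, hR, Matrix.mulVec_mulVec, hRΛ,
          dotProduct_comm]
      rw [h2, h3] at h1
      rw [star_trivial, Matrix.sub_mulVec, Matrix.smul_mulVec, dotProduct_sub, dotProduct_smul,
        smul_eq_mul]
      linarith
  have h4 := (hpsd.conjTranspose_mul_mul_same (P * R)).trace_nonneg
  have h5 : ∀ S : Matrix (Fin d) (Fin d) ℝ,
      ((P * R)ᴴ * S * (P * R)).trace = (Pᵀ * S * P * Λ).trace := fun S => by
    rw [Matrix.conjTranspose_eq_transpose_of_trivial, Matrix.transpose_mul, hR, Matrix.mul_assoc R,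
      Matrix.mul_assoc R, Matrix.trace_mul_comm R, ← hRΛ]
    simp only [Matrix.mul_assoc]
  rw [h5] at h4
  simp only [Matrix.mul_sub, Matrix.sub_mul, Matrix.mul_smul, Matrix.smul_mul, Matrix.trace_sub,
    Matrix.trace_smul, smul_eq_mul] at h4
  linarith

/-- Completing the square in the reduced loss. -/
theorem reducedLoss_eq (hΛ : Λ.PosDef) (hM : 0 < M) (P : Matrix (Fin d) (Fin d) ℝ) :
    reducedLoss Λ N M ε P =
      2 * ((P - (regMat Λ N M ε)⁻¹ * Λ)ᵀ * regMat Λ N M ε * (P - (regMat Λ N M ε)⁻¹ * Λ) *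
        Λ).trace + reducedLoss Λ N M ε ((regMat Λ N M ε)⁻¹ * Λ) := by
  set A := regMat Λ N M ε with hA
  have hApd : A.PosDef := posDef_regMat hΛ hM ε
  have hs : Λᵀ = Λ := (Matrix.conjTranspose_eq_transpose_of_trivial Λ).symm.trans hΛ.isHermitian
  have hAs : Aᵀ = A := (Matrix.conjTranspose_eq_transpose_of_trivial A).symm.trans hApd.isHermitian
  have hdet := (Matrix.isUnit_iff_isUnit_det A).1 hApd.isUnit
  set C := A⁻¹ * Λ with hC
  have hAC : A * C = Λ := by rw [hC, ← Matrix.mul_assoc, Matrix.mul_nonsing_inv _ hdet,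
    Matrix.one_mul]
  have hCA : Cᵀ * A = Λ := by
    have h := congrArg Matrix.transpose hAC
    rwa [Matrix.transpose_mul, hAs, hs] at h
  have h1 : (Pᵀ * Λ * Λ).trace = (Λ * P * Λ).trace := by
    rw [← Matrix.trace_transpose]
    simp only [Matrix.transpose_mul, Matrix.transpose_transpose, hs]
    rw [← Matrix.mul_assoc, Matrix.trace_mul_comm (Λ * Λ), Matrix.trace_mul_comm (Λ * P),
      Matrix.trace_mul_comm P, ← Matrix.mul_assoc]
  have h2 : (Cᵀ * A * C * Λ).trace = (Λ * C * Λ).trace := by rw [hCA]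
  simp only [reducedLoss, ← hA, Matrix.transpose_sub, Matrix.sub_mul, Matrix.mul_sub,
    Matrix.trace_sub, h2]
  rw [Matrix.mul_assoc Pᵀ A C, hAC, h1, hCA]
  ring

/-- The initialization, viewed through the product `P`, has a smaller loss than the saddle point
`P = 0`. -/
theorem reducedLoss_init_lt (hΛ : Λ.PosDef) (hM : 0 < M) {σ : ℝ} (hσ : 0 < σ)
    {Θ : Matrix (Fin d) (Fin d) ℝ} (hΘ : frobNorm (Θ * Θᵀ) = 1)
    (hσlt : σ < Real.sqrt (2 / ((d : ℝ) * opNorm (regMat Λ N M ε * Λ⁻¹)))) :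
    reducedLoss Λ N M ε (σ • (σ • (Θ * Θᵀ))) < 2 * Λ.trace := by
  set P := Θ * Θᵀ with hP
  set b := opNorm (regMat Λ N M ε * Λ⁻¹) with hb
  have hs : Λᵀ = Λ := (Matrix.conjTranspose_eq_transpose_of_trivial Λ).symm.trans hΛ.isHermitian
  have hPs : Pᵀ = P := by rw [hP, Matrix.transpose_mul, Matrix.transpose_transpose]
  have hb0 : 0 ≤ b := opNorm_nonneg _
  have hP0 : P ≠ 0 := fun h => by
    rw [frobNorm_eq_zero.2 h] at hΘ
    exact zero_ne_one hΘ
  have hd : (1 : ℝ) ≤ d := by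
    rcases Nat.eq_zero_or_pos d with rfl | h
    · exact absurd (Subsingleton.elim P 0) hP0
    · exact_mod_cast h
  -- if `d b` were zero, the bound on `σ` would read `σ < √(2 / 0) = 0`
  have hσb : σ ^ 2 * b < 2 := by
    have h1 := (Real.lt_sqrt hσ.le).1 hσlt
    have h2 : 0 < (d : ℝ) * b := by
      by_contra! h
      have h0 : (d : ℝ) * b = 0 := le_antisymm h (by positivity)
      rw [h0, div_zero] at h1
      nlinarith
    rw [lt_div_iff₀ h2] at h1
    nlinarith [mul_nonneg (sq_nonneg σ) hb0]
  set Y := Λ * Θ with hY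
  have hY0 : 0 < frobNorm Y ^ 2 := by
    refine pow_pos (lt_of_le_of_ne (frobNorm_nonneg _) fun h => hP0 ?_) 2
    have h1 : Λ * Θ = 0 := frobNorm_eq_zero.1 h.symm
    have hdet := (Matrix.isUnit_iff_isUnit_det Λ).1 hΛ.isUnit
    have h2 : Θ = 0 := by
      rw [← Matrix.one_mul Θ, ← Matrix.nonsing_inv_mul _ hdet, Matrix.mul_assoc, h1,
        Matrix.mul_zero]
    rw [hP, h2, Matrix.zero_mul]
  have ht : (Λ * P * Λ).trace = frobNorm Y ^ 2 := by
    rw [← frobNorm_transpose, ← trace_transpose_mul_self, Matrix.transpose_transpose, hY, hP,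
      Matrix.transpose_mul, hs]
    simp only [Matrix.mul_assoc]
  -- `tr(P Λ P Λ) = tr(P Y Yᵀ) ≤ ‖P‖ ‖Y Yᵀ‖ ≤ ‖Y‖²`
  have h4 : (Pᵀ * Λ * P * Λ).trace ≤ frobNorm Y ^ 2 := by
    have h1 : Pᵀ * Λ * P * Λ = Pᵀ * (Y * Yᵀ) := by
      rw [hPs, hY, Matrix.transpose_mul Λ Θ, hs, hP]
      simp only [Matrix.mul_assoc]
    have h2 := (le_abs_self _).trans (abs_trace_transpose_mul_le P (Y * Yᵀ))
    have h3 := frobNorm_mul_le Y Yᵀ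
    rw [frobNorm_transpose] at h3
    rw [h1]
    rw [hΘ, one_mul] at h2
    nlinarith
  have h5 := trace_regMat_le (N := N) (ε := ε) hΛ hM P
  rw [← hb] at h5
  have h6 : (Pᵀ * regMat Λ N M ε * P * Λ).trace ≤ b * frobNorm Y ^ 2 :=
    h5.trans (mul_le_mul_of_nonneg_left h4 hb0)
  have hσ2 : 0 < σ ^ 2 := by positivity
  rw [reducedLoss, smul_smul]
  simp only [Matrix.transpose_smul, Matrix.smul_mul, Matrix.mul_smul, Matrix.trace_smul,
    smul_eq_mul, ht]
  have h7 : σ ^ 2 * (Pᵀ * regMat Λ N M ε * P * Λ).trace < 2 * frobNorm Y ^ 2 :=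
    calc _ ≤ σ ^ 2 * (b * frobNorm Y ^ 2) := mul_le_mul_of_nonneg_left h6 hσ2.le
      _ = (σ ^ 2 * b) * frobNorm Y ^ 2 := by ring
      _ < 2 * frobNorm Y ^ 2 := mul_lt_mul_of_pos_right hσb hY0
  nlinarith [mul_lt_mul_of_pos_left h7 hσ2]

end RegMat

/-! ### The flow of the two active blocks -/

section ActiveBlocks

variable {d N M : ℕ} {Λ : Matrix (Fin d) (Fin d) ℝ} {ε : ℝ}

/-- The parameter with `w^V₂₂ = v`, `W^KQ₁₁ = W` and all other entries zero. -/
def mkActive (v : ℝ) (W : Matrix (Fin d) (Fin d) ℝ) : Param d :=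
  mkParam (Matrix.fromBlocks 0 0 0 (Matrix.of fun _ _ => v)) (Matrix.fromBlocks W 0 0 0)

theorem initParam_eq (σ : ℝ) (Θ : Matrix (Fin d) (Fin d) ℝ) :
    initParam σ Θ = mkActive σ (σ • (Θ * Θᵀ)) := rfl

theorem blk22_mkActive (v : ℝ) (W : Matrix (Fin d) (Fin d) ℝ) :
    blk22 (WV (mkActive v W)) = v := rfl

theorem blk11_mkActive (v : ℝ) (W : Matrix (Fin d) (Fin d) ℝ) :
    blk11 (WKQ (mkActive v W)) = W := rfl

theorem offBlockZero_mkActive (v : ℝ) (W : Matrix (Fin d) (Fin d) ℝ) :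
    OffBlockZero (mkActive v W) := ⟨rfl, rfl, rfl, rfl, rfl, rfl⟩

theorem OffBlockZero.eq_mkActive {θ : Param d} (h : OffBlockZero θ) :
    θ = mkActive (blk22 (WV θ)) (blk11 (WKQ θ)) := by
  rw [offBlockZero_iff] at h
  ext i
  rcases i with ⟨i | i, j | j⟩ | ⟨i | i, j | j⟩
  · exact h _ rfl
  · exact h _ rfl
  · exact h _ rfl
  · rfl
  · rfl
  · exact h _ rfl
  · exact h _ rfl
  · exact h _ rfl

theorem mkActive_add_smul (v v' s : ℝ) (W W' : Matrix (Fin d) (Fin d) ℝ) :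
    mkActive v W + s • mkActive v' W' = mkActive (v + s * v') (W + s • W') := by
  ext i
  rcases i with ⟨i | i, j | j⟩ | ⟨i | i, j | j⟩ <;> simp [mkActive, mkParam]

theorem inner_mkActive (v v' : ℝ) (W W' : Matrix (Fin d) (Fin d) ℝ) :
    inner ℝ (mkActive v W) (mkActive v' W') = v * v' + (Wᵀ * W').trace := by
  rw [PiLp.inner_apply]
  simp only [Fintype.sum_sum_type, Fintype.sum_prod_type, mkActive, mkParam, Sum.elim_inl,
    Sum.elim_inr, Matrix.fromBlocks_apply₁₁, Matrix.fromBlocks_apply₁₂, Matrix.fromBlocks_apply₂₁,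
    Matrix.fromBlocks_apply₂₂, Matrix.zero_apply, Matrix.of_apply,
    Finset.univ_unique, Finset.sum_singleton,
    RCLike.inner_apply, conj_trivial, Matrix.trace, Matrix.diag, Matrix.mul_apply,
    Matrix.transpose_apply]
  rw [Finset.sum_comm (f := fun y x => W x y * W' x y)]
  simp [mul_comm]

theorem surrogateLoss_mkActive (hΛ : Λ.PosDef) (hM : 0 < M) (v : ℝ)
    (W : Matrix (Fin d) (Fin d) ℝ) :
    surrogateLoss Λ N M ε (mkActive v W) = reducedLoss Λ N M ε (v • W) :=
  surrogateLoss_of_offBlockZero hΛ.posSemidef hM ε (offBlockZero_mkActive v W)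

theorem inner_gradient_eq_deriv {E : Type*} [NormedAddCommGroup E] [InnerProductSpace ℝ E]
    [CompleteSpace E] {L : E → ℝ} (hL : ContDiff ℝ 2 L) (x h : E) {φ : ℝ → ℝ} {φ' : ℝ}
    (hφ : ∀ s : ℝ, L (x + s • h) = φ s) (hd : HasDerivAt φ φ' 0) :
    inner ℝ (gradient L x) h = φ' := by
  have h1 : HasDerivAt (fun s : ℝ => x + s • h) h 0 := by
    simpa using ((hasDerivAt_id (0 : ℝ)).smul_const h).const_add x
  have h2 : HasFDerivAt L (InnerProductSpace.toDual ℝ E (gradient L x)) (x + (0 : ℝ) • h) := by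
    simpa using (hasGradientAt_gradient hL x).hasFDerivAt
  have h3 := h2.comp_hasDerivAt (0 : ℝ) h1
  rw [InnerProductSpace.toDual_apply_apply] at h3
  have h4 : L ∘ (fun s : ℝ => x + s • h) = φ := funext hφ
  rw [h4] at h3
  exact h3.unique hd

/-- The reduced loss along a ray is a quadratic polynomial. -/
theorem reducedLoss_smul (r : ℝ) (P : Matrix (Fin d) (Fin d) ℝ) :
    reducedLoss Λ N M ε (r • P) =
      2 * (r ^ 2 * (Pᵀ * regMat Λ N M ε * P * Λ).trace - 2 * (r * (Λ * P * Λ).trace)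
        + Λ.trace) := by
  simp only [reducedLoss, Matrix.transpose_smul, Matrix.smul_mul, Matrix.mul_smul,
    Matrix.trace_smul, smul_eq_mul]
  ring

/-- The gradient is orthogonal to the generator of the scaling `(v, W) ↦ (e^s v, e^{-s} W)`, along
which the product `v W` does not move. -/
theorem inner_gradient_mkActive_neg (hΛ : Λ.PosDef) (hM : 0 < M) (v : ℝ)
    (W : Matrix (Fin d) (Fin d) ℝ) :
    inner ℝ (gradient (surrogateLoss Λ N M ε) (mkActive v W)) (mkActive v (-W)) = 0 := by
  -- along the tangent line `((1 + s) v, (1 - s) W)` the product is `(1 - s²) v W`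
  refine inner_gradient_eq_deriv (contDiff_surrogateLoss N M Λ ε) _ _
    (φ := fun s => reducedLoss Λ N M ε ((1 - s ^ 2) • (v • W))) (fun s => ?_) ?_
  · rw [mkActive_add_smul, surrogateLoss_mkActive hΛ hM]
    congr 1
    ext i j
    simp
    ring
  · simp only [reducedLoss_smul]
    have h1 : HasDerivAt (fun s : ℝ => 1 - s ^ 2) 0 0 := by
      simpa using ((hasDerivAt_id (0 : ℝ)).pow 2).const_sub 1
    have h2 := ((((h1.pow 2).mul_const ((v • W)ᵀ * regMat Λ N M ε * (v • W) * Λ).trace).sub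
      ((h1.mul_const (Λ * (v • W) * Λ).trace).const_mul 2)).add_const Λ.trace).const_mul 2
    simpa using h2

/-- The excess loss is read off from the derivative in the direction `D = v W - A⁻¹ Λ` of
`W^KQ₁₁`. -/
theorem inner_gradient_mkActive_residual (hΛ : Λ.PosDef) (hM : 0 < M) (v : ℝ)
    (W : Matrix (Fin d) (Fin d) ℝ) {D : Matrix (Fin d) (Fin d) ℝ}
    (hD : D = v • W - (regMat Λ N M ε)⁻¹ * Λ) :
    inner ℝ (gradient (surrogateLoss Λ N M ε) (mkActive v W)) (mkActive 0 D) =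
      4 * v * (Dᵀ * regMat Λ N M ε * D * Λ).trace := by
  refine inner_gradient_eq_deriv (contDiff_surrogateLoss N M Λ ε) _ _
    (φ := fun s => 2 * ((1 + s * v) ^ 2 * (Dᵀ * regMat Λ N M ε * D * Λ).trace) +
      reducedLoss Λ N M ε ((regMat Λ N M ε)⁻¹ * Λ)) (fun s => ?_) ?_
  · rw [mkActive_add_smul, surrogateLoss_mkActive hΛ hM, reducedLoss_eq hΛ hM]
    have h1 : (v + s * 0) • (W + s • D) - (regMat Λ N M ε)⁻¹ * Λ = (1 + s * v) • D := by
      have : (v + s * 0) • (W + s • D) - (regMat Λ N M ε)⁻¹ * Λ = D + (s * v) • D := by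
        rw [mul_zero, add_zero, smul_add, smul_smul, mul_comm v s, hD]
        abel
      rw [this, add_smul, one_smul]
    rw [h1]
    simp only [Matrix.transpose_smul, Matrix.smul_mul, Matrix.mul_smul, Matrix.trace_smul,
      smul_eq_mul]
    ring
  · have h1 : HasDerivAt (fun s : ℝ => 1 + s * v) v 0 := by
      simpa using ((hasDerivAt_id (0 : ℝ)).mul_const v).const_add 1
    have h2 := (((h1.pow 2).mul_const (Dᵀ * regMat Λ N M ε * D * Λ).trace).const_mul 2).add_const
      (reducedLoss Λ N M ε ((regMat Λ N M ε)⁻¹ * Λ))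
    refine h2.congr_deriv ?_
    simp
    ring

/-- A Polyak–Łojasiewicz inequality, uniform as long as `w^V₂₂` stays away from zero. -/
theorem exists_polyakLojasiewicz (hΛ : Λ.PosDef) (hM : 0 < M) :
    ∃ κ : ℝ, 0 < κ ∧ ∀ (v : ℝ) (W : Matrix (Fin d) (Fin d) ℝ),
      κ * v ^ 2 * (surrogateLoss Λ N M ε (mkActive v W) -
        reducedLoss Λ N M ε ((regMat Λ N M ε)⁻¹ * Λ)) ≤
      ‖gradient (surrogateLoss Λ N M ε) (mkActive v W)‖ ^ 2 := by
  obtain ⟨c, hc, hq⟩ := exists_mul_frobNorm_sq_le_trace (posDef_regMat (N := N) hΛ hM ε) hΛ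
  refine ⟨8 * c, by positivity, fun v W => ?_⟩
  set D := v • W - (regMat Λ N M ε)⁻¹ * Λ with hD
  set q := (Dᵀ * regMat Λ N M ε * D * Λ).trace with hqdef
  set G := gradient (surrogateLoss Λ N M ε) (mkActive v W) with hG
  have hL : surrogateLoss Λ N M ε (mkActive v W) -
      reducedLoss Λ N M ε ((regMat Λ N M ε)⁻¹ * Λ) = 2 * q := by
    rw [surrogateLoss_mkActive hΛ hM, reducedLoss_eq hΛ hM]
    ring
  have h1 : inner ℝ G (mkActive 0 D) = 4 * v * q := inner_gradient_mkActive_residual hΛ hM v W hD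
  have h2 : ‖(mkActive 0 D : Param d)‖ ^ 2 = frobNorm D ^ 2 := by
    rw [← real_inner_self_eq_norm_sq, inner_mkActive, trace_transpose_mul_self]
    ring
  have h3 : (4 * v * q) ^ 2 ≤ ‖G‖ ^ 2 * frobNorm D ^ 2 := by
    rw [← h1, ← h2, ← mul_pow]
    exact sq_le_sq' (neg_le_of_abs_le (abs_real_inner_le_norm _ _)) (real_inner_le_norm _ _)
  have h4 := hq D
  have hq0 : 0 ≤ q := (mul_nonneg hc.le (sq_nonneg _)).trans h4
  rw [hL]
  rcases hq0.eq_or_lt with h0 | hpos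
  · rw [← h0]
    simp
  · refine le_of_mul_le_mul_right ?_ hpos
    nlinarith [mul_le_mul_of_nonneg_left h3 hc.le, mul_le_mul_of_nonneg_left h4 (sq_nonneg ‖G‖)]

/-- If the loss is below its value `2 tr Λ` at the origin and the blocks are balanced, then
`w^V₂₂` is bounded away from zero. -/
theorem exists_le_sq_of_loss_le (hΛ : Λ.PosDef) (hM : 0 < M) {l : ℝ} (hl : l < 2 * Λ.trace) :
    ∃ δ : ℝ, 0 < δ ∧ ∀ (v : ℝ) (W : Matrix (Fin d) (Fin d) ℝ), v ^ 2 = frobNorm W ^ 2 →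
      surrogateLoss Λ N M ε (mkActive v W) ≤ l → δ ≤ v ^ 2 := by
  have hs : Λᵀ = Λ := (Matrix.conjTranspose_eq_transpose_of_trivial Λ).symm.trans hΛ.isHermitian
  obtain ⟨c, hc, hq⟩ := exists_mul_frobNorm_sq_le_trace (posDef_regMat (N := N) hΛ hM ε) hΛ
  set K := frobNorm (Λ * Λ) with hK
  have hK0 : 0 ≤ K := frobNorm_nonneg _
  have hη : 0 < 2 * Λ.trace - l := sub_pos.2 hl
  -- under balance the loss is at least `2 tr Λ - 4 K v²`; `K + 1` covers the case `K = 0`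
  refine ⟨(2 * Λ.trace - l) / (4 * (K + 1)), by positivity, fun v W hvW hle => ?_⟩
  rw [surrogateLoss_mkActive hΛ hM, reducedLoss_smul] at hle
  have h1 := (mul_nonneg hc.le (sq_nonneg _)).trans (hq W)
  have h2 : (Λ * W * Λ).trace = ((Λ * Λ)ᵀ * W).trace := by
    rw [Matrix.transpose_mul, hs, Matrix.trace_mul_comm, ← Matrix.mul_assoc]
  have h3 := abs_trace_transpose_mul_le (Λ * Λ) W
  rw [← h2] at h3
  have h4 : |v| = frobNorm W := by
    rw [← Real.sqrt_sq_eq_abs, hvW, Real.sqrt_sq (frobNorm_nonneg W)]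
  have h5 : v * (Λ * W * Λ).trace ≤ K * v ^ 2 := by
    calc v * (Λ * W * Λ).trace ≤ |v| * |(Λ * W * Λ).trace| := by
          rw [← abs_mul]; exact le_abs_self _
      _ ≤ |v| * (K * frobNorm W) := mul_le_mul_of_nonneg_left h3 (abs_nonneg v)
      _ = K * v ^ 2 := by rw [← h4, ← sq_abs v]; ring
  rw [div_le_iff₀ (by positivity)]
  nlinarith [mul_nonneg (sq_nonneg v) h1, sq_nonneg v]

/-- The isometry of the parameter space which negates `W^KQ`. On parameters with vanishing
off-blocks its quadratic form is `(w^V₂₂)² - ‖W^KQ₁₁‖²`. -/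
noncomputable def keyQueryFlip (d : ℕ) : Param d ≃ₗᵢ[ℝ] Param d :=
  LinearIsometryEquiv.piLpCongrRight 2
    (Sum.elim (fun _ => LinearIsometryEquiv.refl ℝ ℝ) fun _ => LinearIsometryEquiv.neg ℝ)

theorem keyQueryFlip_keyQueryFlip (x : Param d) : keyQueryFlip d (keyQueryFlip d x) = x := by
  ext i
  rcases i with i | i <;> simp [keyQueryFlip]

theorem inner_keyQueryFlip_comm (x y : Param d) :
    inner ℝ (keyQueryFlip d x) y = inner ℝ x (keyQueryFlip d y) := by
  rw [← (keyQueryFlip d).inner_map_map x, keyQueryFlip_keyQueryFlip]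

theorem keyQueryFlip_mkActive (v : ℝ) (W : Matrix (Fin d) (Fin d) ℝ) :
    keyQueryFlip d (mkActive v W) = mkActive v (-W) := by
  ext i
  rcases i with ⟨i | i, j | j⟩ | ⟨i | i, j | j⟩ <;> simp [mkActive, mkParam, keyQueryFlip]

/-- Along a gradient flow line with vanishing off-blocks, `(w^V₂₂)² - ‖W^KQ₁₁‖²` is conserved. -/
theorem balance_conserved (hΛ : Λ.PosDef) (hM : 0 < M) {θ : ℝ → Param d}
    (hθ : IsGradientFlow (surrogateLoss Λ N M ε) θ) (hoff : ∀ t, 0 ≤ t → OffBlockZero (θ t))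
    {t : ℝ} (ht : 0 ≤ t) :
    blk22 (WV (θ t)) ^ 2 - frobNorm (blk11 (WKQ (θ t))) ^ 2 =
      blk22 (WV (θ 0)) ^ 2 - frobNorm (blk11 (WKQ (θ 0))) ^ 2 := by
  have hflow := (isGradientFlow_iff (contDiff_surrogateLoss N M Λ ε)).1 hθ
  have hbal : ∀ s, 0 ≤ s → inner ℝ (θ s) (keyQueryFlip d (θ s)) =
      blk22 (WV (θ s)) ^ 2 - frobNorm (blk11 (WKQ (θ s))) ^ 2 := fun s hs => by
    conv_lhs => rw [(hoff s hs).eq_mkActive]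
    rw [keyQueryFlip_mkActive, inner_mkActive, Matrix.mul_neg, Matrix.trace_neg,
      trace_transpose_mul_self]
    ring
  have hgrad : ∀ s, 0 ≤ s →
      inner ℝ (gradient (surrogateLoss Λ N M ε) (θ s)) (keyQueryFlip d (θ s)) = 0 := fun s hs => by
    conv_lhs => rw [(hoff s hs).eq_mkActive]
    rw [keyQueryFlip_mkActive]
    exact inner_gradient_mkActive_neg hΛ hM _ _
  have hd : ∀ s ∈ Ici (0 : ℝ),
      HasDerivWithinAt (fun s => inner ℝ (θ s) (keyQueryFlip d (θ s))) 0 (Ici 0) s := by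
    intro s hs
    have h1 := hflow s hs
    have h2 : HasDerivWithinAt (fun s => keyQueryFlip d (θ s))
        (keyQueryFlip d (-gradient (surrogateLoss Λ N M ε) (θ s))) (Ici 0) s :=
      (keyQueryFlip d).toContinuousLinearEquiv.toContinuousLinearMap.hasFDerivAt
        |>.comp_hasDerivWithinAt s h1
    refine (h1.inner ℝ h2).congr_deriv ?_
    rw [← inner_keyQueryFlip_comm, real_inner_comm, inner_neg_left, hgrad s hs]
    simp
  have hconst := (convex_Ici (0 : ℝ)).is_const_of_fderivWithin_eq_zero (𝕜 := ℝ)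
    (f := fun s => inner ℝ (θ s) (keyQueryFlip d (θ s)))
    (fun s hs => (hd s hs).differentiableWithinAt) (fun s hs => by
      have := (hd s hs).hasFDerivWithinAt.fderivWithin ((uniqueDiffOn_Ici 0) s hs)
      rw [this]
      ext
      simp) ht self_mem_Ici
  rw [← hbal t ht, ← hbal 0 le_rfl]
  exact hconst

end ActiveBlocks

end ICLAT

open ICLAT in
theorem mainTheorem3 (d N M : ℕ) (hM : 0 < M)
    (Λ : Matrix (Fin d) (Fin d) ℝ) (hΛ : Λ.PosDef) (ε : ℝ) (hε : 0 ≤ ε)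
    (σ : ℝ) (hσ : 0 < σ) (Θ : Matrix (Fin d) (Fin d) ℝ)
    (hΘ : ICLAT.frobNorm (Θ * Θᵀ) = 1) (hΘΛ : Θ * Λ ≠ 0)
    (hσlt : σ < Real.sqrt (2 / ((d : ℝ) * ICLAT.opNorm (ICLAT.regMat Λ N M ε * Λ⁻¹)))) :
    (∃ θ : ℝ → ICLAT.Param d,
      ICLAT.IsGradientFlow (ICLAT.surrogateLoss Λ N M ε) θ ∧ θ 0 = ICLAT.initParam σ Θ) ∧
    ∀ θ : ℝ → ICLAT.Param d,
      ICLAT.IsGradientFlow (ICLAT.surrogateLoss Λ N M ε) θ → θ 0 = ICLAT.initParam σ Θ →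
      (∀ t : ℝ, 0 ≤ t → ICLAT.OffBlockZero (θ t)) ∧
      ∃ θlim : ICLAT.Param d,
        Tendsto θ atTop (𝓝 θlim) ∧ ICLAT.OffBlockZero θlim ∧
        IsUnit (ICLAT.regMat Λ N M ε) ∧
        ICLAT.blk22 (ICLAT.WV θlim) • ICLAT.blk11 (ICLAT.WKQ θlim) =
          (ICLAT.regMat Λ N M ε)⁻¹ * Λ := by
  have hL := contDiff_surrogateLoss N M Λ ε
  refine ⟨exists_isGradientFlow hL (surrogateLoss_nonneg N M Λ ε) _, fun θ hθ h0 => ?_⟩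
  have hoff : ∀ t : ℝ, 0 ≤ t → OffBlockZero (θ t) := fun t ht => by
    rw [offBlockZero_iff_blockFlip_eq]
    refine hθ.apply_eq_of_symm hL (blockFlip d) (surrogateLoss_blockFlip ε) ?_ ht
    rw [← offBlockZero_iff_blockFlip_eq, h0, initParam_eq]
    exact offBlockZero_mkActive _ _
  refine ⟨hoff, ?_⟩
  set v : ℝ → ℝ := fun t => blk22 (WV (θ t)) with hv
  set W : ℝ → Matrix (Fin d) (Fin d) ℝ := fun t => blk11 (WKQ (θ t)) with hW
  have hθeq : ∀ t, 0 ≤ t → θ t = mkActive (v t) (W t) := fun t ht => (hoff t ht).eq_mkActive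
  have hbal : ∀ t, 0 ≤ t → v t ^ 2 = frobNorm (W t) ^ 2 := fun t ht => by
    have h1 := balance_conserved hΛ hM hθ hoff ht
    rw [h0, initParam_eq, blk22_mkActive, blk11_mkActive, ← trace_transpose_mul_self (σ • _)] at h1
    simp only [Matrix.transpose_smul, Matrix.smul_mul, Matrix.mul_smul, Matrix.trace_smul,
      smul_eq_mul] at h1
    rw [trace_transpose_mul_self, hΘ] at h1
    change v t ^ 2 - frobNorm (W t) ^ 2 = _ at h1
    linarith
  have hl0 : surrogateLoss Λ N M ε (θ 0) < 2 * Λ.trace := by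
    rw [h0, initParam_eq, surrogateLoss_mkActive hΛ hM]
    exact reducedLoss_init_lt hΛ hM hσ hΘ hσlt
  obtain ⟨δ, hδ, hvδ⟩ := exists_le_sq_of_loss_le (N := N) (ε := ε) hΛ hM hl0
  obtain ⟨κ, hκ, hPL⟩ := exists_polyakLojasiewicz (N := N) (ε := ε) hΛ hM
  obtain ⟨c, hc, hq⟩ := exists_mul_frobNorm_sq_le_trace (posDef_regMat (N := N) hΛ hM ε) hΛ
  set C := (regMat Λ N M ε)⁻¹ * Λ with hC
  have hmin : ∀ t, 0 ≤ t → reducedLoss Λ N M ε C ≤ surrogateLoss Λ N M ε (θ t) := fun t ht => by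
    rw [hθeq t ht, surrogateLoss_mkActive hΛ hM, reducedLoss_eq hΛ hM (v t • W t), ← hC]
    have := (mul_nonneg hc.le (sq_nonneg _)).trans (hq (v t • W t - C))
    linarith
  obtain ⟨x, hx, hxL⟩ := hθ.exists_tendsto hL (mul_pos hκ hδ) hmin fun t ht => by
    have h1 := hPL (v t) (W t)
    rw [← hθeq t ht] at h1
    refine le_trans ?_ h1
    have h2 : δ ≤ v t ^ 2 := hvδ (v t) (W t) (hbal t ht)
      (hθeq t ht ▸ hθ.loss_antitone hL le_rfl ht)
    exact mul_le_mul_of_nonneg_right (mul_le_mul_of_nonneg_left h2 hκ.le)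
      (sub_nonneg.2 (hmin t ht))
  have hxoff : OffBlockZero x := by
    rw [offBlockZero_iff_blockFlip_eq]
    have h1 : Tendsto (fun t => blockFlip d (θ t)) atTop (𝓝 (blockFlip d x)) :=
      ((blockFlip d).continuous.tendsto x).comp hx
    refine tendsto_nhds_unique h1 (hx.congr' ?_)
    filter_upwards [eventually_ge_atTop 0] with t ht
    exact ((offBlockZero_iff_blockFlip_eq _).1 (hoff t ht)).symm
  refine ⟨x, hx, hxoff, (posDef_regMat hΛ hM ε).isUnit, ?_⟩
  -- the limit has minimal loss, and `A⁻¹ Λ` is the only minimizer of the reduced loss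
  rw [surrogateLoss_of_offBlockZero hΛ.posSemidef hM ε hxoff,
    reducedLoss_eq hΛ hM (blk22 (WV x) • blk11 (WKQ x)), ← hC] at hxL
  have h1 := hq (blk22 (WV x) • blk11 (WKQ x) - C)
  have h2 : frobNorm (blk22 (WV x) • blk11 (WKQ x) - C) ^ 2 ≤ 0 := by
    by_contra! h
    have := mul_pos hc h
    linarith
  exact sub_eq_zero.1 (frobNorm_eq_zero.1 (sq_eq_zero_iff.1 (le_antisymm h2 (sq_nonneg _))))
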